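/- **Theorem (explicit Poisson kernel formula).** Let $d\ge 2$ and let $\Gamma_d$ be the infinite rooted tree with root $e$ in which every vertex $x$ has exactly $d$ successors $x_1,\dots,x_d$. Write $|x|$ for the distance from $x$ to $e$, $x_0$ for the predecessor of $x\ne e$, and $\Gamma_x$ for the subtree consisting of $x$ and all its descendants. Let $\lambda_n>0$ and $\beta_n\in\mathbb R$ ($n\ge 0$), and let $J$ be the operator in $\ell^2(\Gamma_d)$ whose domain is the space of finitely supported functions and which satisfies $$J\delta_x=\lambda_{n-1}\delta_{x_0}+\beta_n\delta_x+\lambda_n(\delta_{x_1}+\dots+\delta_{x_d}),\qquad n=|x|,$$ where the first term is absent for $x=e$. The same formula, $(Jv)(x)=\lambda_{n-1}v(x_0)+\beta_nv(x)+\lambda_n\sum_i v(x_i)$, defines $Jv$ for every function $v$ on $\Gamma_d$. Assume that $J$ is not essentially selfadjoint, let $z\in\mathbb C\setminus\mathbb R$, and let $N_z(J)=\big(\operatorname{Im}(J-\bar zI)\big)^{\perp}\subseteq\ell^2(\Gamma_d)$ be the deficiency space. Let $p_n=p_n(z)$ and $q_n=q_n(z)$ be the solutions of $$z a_n=\sqrt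 d\,\lambda_{n-1}a_{n-1}+\beta_na_n+\sqrt d\,\lambda_na_{n+1}\quad(n\ge1)$$ with $p_0=1$, $p_1=(z-\beta_0)/(\sqrt d\,\lambda_0)$ and $q_0=0$, $q_1=1/\lambda_0$, and put $$\alpha_0(z)=\Big(\sum_{n\ge0}|p_n|^2\Big)^{1/2},\qquad \alpha_k(z)=\lambda_{k-1}\Big(\sum_{n\ge k}|p_{k-1}q_n-q_{k-1}p_n|^2\Big)^{1/2}\quad(k\ge1).$$ Let $\Omega\cong\{0,\dots,d-1\}^{\mathbb N}$ be the boundary of $\Gamma_d$, that is, the set of infinite descending paths from $e$, let $d\omega$ be the product of the uniform probability measures on $\{0,\dots,d-1\}$, and let $\Omega_x\subseteq\Omega$ be the set of paths through $x$. Then: 1. The series defining $\alpha_k(z)$ converge and $0<\alpha_k(z)<\infty$ for all $k\ge0$. 2. For each vertex $x$ there is exactly one $f_x\in\ell^2(\Gamma_d)$ that vanishes outside $\Gamma_x$, is constant on each level of $\Gamma_x$, satisfies $f_x(x)=1$, and satisfies $(Jf_x)(y)=zf_x(y)$ for all $y\in\Gamma_x$. Moreover $\|f_x\|=\alpha_{|x|}(z)$.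 3. Let $F_x=\alpha_{|x|}(z)\sqrt{d^{|x|}}\,\mathbf 1_{\Omega_x}$. There is exactly one linear isometry $U$ of $L^2(\Omega,d\omega)$ onto $N_z(J)$ such that $UF_e=f_e$ and $U\big(\sum_{i=1}^d a_iF_{x_i}\big)=\sum_{i=1}^d a_if_{x_i}$ for all $x\in\Gamma_d$ and all $a_1,\dots,a_d\in\mathbb C$ with $\sum_i a_i=0$. 4. For every $y\in\Gamma_d$ there is one, and up to $d\omega$-null sets only one, function $P_z(y,\cdot)\in L^2(\Omega,d\omega)$ such that $$(UF)(y)=\int_\Omega P_z(y,\omega)F(\omega)\,d\omega\qquad\text{for all }F\in L^2(\Omega,d\omega),$$ and it is given, with $n=|y|$ and $e=y_0,y_1,\dots,y_n=y$ the path from $e$ to $y$, by $$P_z(y,\omega)=\frac{f_e(y)}{\alpha_0(z)}+\sum_{i=1}^n\frac{f_{y_i}(y)}{\alpha_i(z)}\sqrt{d^i}\,\Big[\mathbf 1_{\Omega_{y_i}}(\omega)-\frac1d\mathbf 1_{\Omega_{y_{i-1}}}(\omega)\Big].$$ -/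

import Mathlib

open MeasureTheory
open scoped BigOperators lp ComplexConjugate

noncomputable section

namespace JacobiTree

/-! ### The rooted homogeneous tree -/

/-- The vertices of the rooted tree in which every vertex has `d` successors. A vertex is the
finite word of the choices made on the way down from the root, the last choice first. The root is
the empty word and the length of a vertex is the length of the word. -/
abbrev Vertex (d : ℕ) : Type := List (Fin d)

/-- The root `e`. -/
abbrev root (d : ℕ) : Vertex d := []

/-- The successors `x_1, …, x_d` of a vertex `x`. -/
abbrev succ {d : ℕ} (x : Vertex d) (i : Fin d) : Vertex d := i :: x

/-- The subtree `Γ_x`: all vertices whose path from the root passes through `x`. -/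
def subtree {d : ℕ} (x : Vertex d) : Set (Vertex d) := {y | x <:+ y}

/-- The vertex `y_i` of length `i` on the path from the root to `y` (for `i ≤ |y|`). -/
def pathTo {d : ℕ} (y : Vertex d) (i : ℕ) : Vertex d := y.drop (y.length - i)

/-- The Hilbert space `ℓ²(Γ_d)`. -/
abbrev L2Tree (d : ℕ) : Type := ℓ²(Vertex d, ℂ)

/-- The function `δ_x`. -/
def delta {d : ℕ} (x : Vertex d) : L2Tree d := lp.single 2 x (1 : ℂ)

theorem orthonormal_delta (d : ℕ) : Orthonormal ℂ (delta : Vertex d → L2Tree d) := by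
  classical
  rw [orthonormal_iff_ite]
  intro x y
  rw [delta, delta, lp.inner_single_left, lp.single_apply]
  by_cases h : x = y
  · subst h; simp
  · simp [h]

/-! ### The Jacobi operator on the tree -/

/-- The vector `J δ_x = λ_{n-1} δ_{x_0} + β_n δ_x + λ_n (δ_{x_1} + ⋯ + δ_{x_d})`, where `n = |x|` and
where the first term is absent if `x` is the root. -/
def jacobiDelta {d : ℕ} (lam bet : ℕ → ℝ) : Vertex d → L2Tree d
  | [] => (bet 0 : ℂ) • delta (root d) + (lam 0 : ℂ) • ∑ i : Fin d, delta (succ (root d) i)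
  | j :: x₀ => (lam x₀.length : ℂ) • delta x₀ + (bet (x₀.length + 1) : ℂ) • delta (j :: x₀)
      + (lam (x₀.length + 1) : ℂ) • ∑ i : Fin d, delta (succ (j :: x₀) i)

/-- The Jacobi operator `J`: its domain is the space of finitely supported functions, that is the
linear span of the `δ_x`, on which it is the linear map with the values `jacobiDelta` at `δ_x`. -/
def jacobiOperator (d : ℕ) (lam bet : ℕ → ℝ) : L2Tree d →ₗ.[ℂ] L2Tree d where
  domain := Submodule.span ℂ (Set.range delta)
  toFun := (Finsupp.linearCombination ℂ (jacobiDelta lam bet)).comp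
    ((orthonormal_delta d).linearIndependent.repr : _ →ₗ[ℂ] (Vertex d →₀ ℂ))

theorem delta_mem_domain {d : ℕ} (lam bet : ℕ → ℝ) (x : Vertex d) :
    delta x ∈ (jacobiOperator d lam bet).domain :=
  Submodule.subset_span ⟨x, rfl⟩

theorem jacobiOperator_delta {d : ℕ} (lam bet : ℕ → ℝ) (x : Vertex d) :
    jacobiOperator d lam bet ⟨delta x, delta_mem_domain lam bet x⟩ = jacobiDelta lam bet x := by
  have h := (orthonormal_delta d).linearIndependent.repr_eq_single x
    ⟨delta x, delta_mem_domain lam bet x⟩ rfl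
  change Finsupp.linearCombination ℂ (jacobiDelta lam bet)
    ((orthonormal_delta d).linearIndependent.repr ⟨delta x, delta_mem_domain lam bet x⟩) = _
  rw [h]
  simp

/-- A (densely defined symmetric) operator is essentially selfadjoint if its closure is
selfadjoint. -/
def IsEssentiallySelfAdjoint {H : Type*} [NormedAddCommGroup H] [InnerProductSpace ℂ H]
    [CompleteSpace H] (A : H →ₗ.[ℂ] H) : Prop :=
  IsSelfAdjoint A.closure

/-- The deficiency space `N_z(A)`, the orthogonal complement of the image of `A - z̄ I`. -/
def deficiencySpace {H : Type*} [NormedAddCommGroup H] [InnerProductSpace ℂ H]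
    (A : H →ₗ.[ℂ] H) (z : ℂ) : Submodule ℂ H :=
  (LinearMap.range (A.toFun - conj z • A.domain.subtype))ᗮ

/-- The formula for `J` applied to an arbitrary function `v` on the tree:
`(J v)(x) = λ_{n-1} v(x_0) + β_n v(x) + λ_n (v(x_1) + ⋯ + v(x_d))`, `n = |x|`. -/
def jacobiAction {d : ℕ} (lam bet : ℕ → ℝ) (v : Vertex d → ℂ) : Vertex d → ℂ
  | [] => (bet 0 : ℂ) * v (root d) + (lam 0 : ℂ) * ∑ i : Fin d, v (succ (root d) i)
  | j :: x₀ => (lam x₀.length : ℂ) * v x₀ + (bet (x₀.length + 1) : ℂ) * v (j :: x₀)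
      + (lam (x₀.length + 1) : ℂ) * ∑ i : Fin d, v (succ (j :: x₀) i)

/-- The property that characterizes `f_x`: a square-summable function that vanishes outside the
subtree `Γ_x`, is constant on the levels of `Γ_x`, has the value `1` at `x`, and satisfies the
equations `(J f)(y) = z f(y)` of the deficiency space at all vertices `y` of `Γ_x`. -/
structure IsRadialDeficiencyFunction {d : ℕ} (lam bet : ℕ → ℝ) (z : ℂ) (x : Vertex d)
    (f : L2Tree d) : Prop where
  eq_zero : ∀ y, y ∉ subtree x → f y = 0
  radial : ∀ y ∈ subtree x, ∀ y' ∈ subtree x, y.length = y'.length → f y = f y'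
  apply_self : f x = 1
  eigen : ∀ y ∈ subtree x, jacobiAction lam bet f y = z * f y

/-! ### The numbers `p_n(z)`, `q_n(z)` and `α_k(z)` -/

/-- The orthogonal polynomials `p_n` of the Jacobi matrix with diagonal `β_n` and off-diagonal
entries `√d λ_n`, evaluated at `z`. -/
def polyP (d : ℕ) (lam bet : ℕ → ℝ) (z : ℂ) : ℕ → ℂ
  | 0 => 1
  | 1 => (z - bet 0) / ((√(d : ℝ) * lam 0 : ℝ) : ℂ)
  | n + 2 => ((z - bet (n + 1)) * polyP d lam bet z (n + 1)
      - ((√(d : ℝ) * lam n : ℝ) : ℂ) * polyP d lam bet z n) / ((√(d : ℝ) * lam (n + 1) : ℝ) : ℂ)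

/-- The polynomials `q_n` of the second kind for the same matrix, evaluated at `z` and normalized
by `q_0 = 0`, `q_1 = 1 / λ_0`. -/
def polyQ (d : ℕ) (lam bet : ℕ → ℝ) (z : ℂ) : ℕ → ℂ
  | 0 => 0
  | 1 => 1 / (lam 0 : ℂ)
  | n + 2 => ((z - bet (n + 1)) * polyQ d lam bet z (n + 1)
      - ((√(d : ℝ) * lam n : ℝ) : ℂ) * polyQ d lam bet z n) / ((√(d : ℝ) * lam (n + 1) : ℝ) : ℂ)

/-- The `n`-th term of the series that defines `α_k(z)²`: `|p_n(z)|²` if `k = 0`, and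
`λ_{k-1}² |p_{k-1}(z) q_{k+n}(z) - q_{k-1}(z) p_{k+n}(z)|²` if `k ≥ 1`. -/
def alphaTerm (d : ℕ) (lam bet : ℕ → ℝ) (z : ℂ) : ℕ → ℕ → ℝ
  | 0, n => ‖polyP d lam bet z n‖ ^ 2
  | k + 1, n => lam k ^ 2 * ‖polyP d lam bet z k * polyQ d lam bet z (k + 1 + n)
      - polyQ d lam bet z k * polyP d lam bet z (k + 1 + n)‖ ^ 2

/-- The number `α_k(z)`. -/
def alpha (d : ℕ) (lam bet : ℕ → ℝ) (z : ℂ) (k : ℕ) : ℝ :=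
  √(∑' n, alphaTerm d lam bet z k n)

/-! ### The boundary -/

/-- The boundary `Ω` of the tree: an infinite path from the root is given by the choice of a
successor at every step. -/
abbrev Boundary (d : ℕ) : Type := ℕ → Fin d

/-- The vertex of length `n` on the infinite path `ω`. -/
def vertexAt {d : ℕ} (ω : Boundary d) : ℕ → Vertex d
  | 0 => root d
  | n + 1 => succ (vertexAt ω n) (ω n)

/-- The cylinder `Ω_x` of all infinite paths that contain the vertex `x`. -/
def cylinder {d : ℕ} (x : Vertex d) : Set (Boundary d) := {ω | ∃ n, vertexAt ω n = x}

/-- The product of the uniform probability measures on `Fin d`. -/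
def boundaryMeasure (d : ℕ) [NeZero d] : Measure (Boundary d) :=
  Measure.infinitePi fun _ => ProbabilityTheory.uniformOn (Set.univ : Set (Fin d))

instance (d : ℕ) [NeZero d] : IsProbabilityMeasure (boundaryMeasure d) := by
  unfold boundaryMeasure; infer_instance

theorem measurable_vertexAt {d : ℕ} (n : ℕ) :
    @Measurable (Boundary d) (Vertex d) _ ⊤ fun ω => vertexAt ω n := by
  induction n with
  | zero => exact @measurable_const _ _ ⊤ _ _
  | succ n ih =>
    let _ : MeasurableSpace (Vertex d) := ⊤
    have : DiscreteMeasurableSpace (Vertex d) := ⟨fun _ => trivial⟩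
    have h : Measurable fun s : Vertex d × Fin d => succ s.1 s.2 := measurable_of_countable _
    exact h.comp (ih.prodMk (measurable_pi_apply n))

theorem measurableSet_cylinder {d : ℕ} (x : Vertex d) : MeasurableSet (cylinder x) := by
  let _ : MeasurableSpace (Vertex d) := ⊤
  have h : cylinder x = ⋃ n, (fun ω : Boundary d => vertexAt ω n) ⁻¹' {x} := by
    ext ω; simp [cylinder]
  rw [h]
  exact MeasurableSet.iUnion fun n => measurable_vertexAt n trivial

/-- The space `L²(Ω, dω)` of complex-valued functions. -/
abbrev L2Boundary (d : ℕ) [NeZero d] : Type := Lp ℂ 2 (boundaryMeasure d)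

/-- The characteristic function of `Ω_x` as an element of `L²(Ω, dω)`. -/
def cylinderIndicator {d : ℕ} [NeZero d] (x : Vertex d) : L2Boundary d :=
  indicatorConstLp 2 (measurableSet_cylinder x) (measure_ne_top (boundaryMeasure d) _) (1 : ℂ)

/-- The function `F_x = α_{|x|}(z) √(d^{|x|}) 1_{Ω_x}`; in particular `F_e = α_0(z)`. -/
def boundaryF {d : ℕ} [NeZero d] (lam bet : ℕ → ℝ) (z : ℂ) (x : Vertex d) : L2Boundary d :=
  ((alpha d lam bet z x.length * √((d : ℝ) ^ x.length) : ℝ) : ℂ) • cylinderIndicator x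

/-- `U` maps `F_e` to `f_e`, and `∑ a_i F_{x_i}` to `∑ a_i f_{x_i}` for all vertices `x` and all
coefficients with `∑ a_i = 0`. -/
structure IsBoundaryCorrespondence {d : ℕ} [NeZero d] {lam bet : ℕ → ℝ} {z : ℂ}
    (f : Vertex d → L2Tree d)
    (U : L2Boundary d ≃ₗᵢ[ℂ] deficiencySpace (jacobiOperator d lam bet) z) : Prop where
  map_root : (U (boundaryF lam bet z (root d)) : L2Tree d) = f (root d)
  map_succ : ∀ (x : Vertex d) (a : Fin d → ℂ), ∑ i, a i = 0 →
    (U (∑ i, a i • boundaryF lam bet z (succ x i)) : L2Tree d) = ∑ i, a i • f (succ x i)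

/-- The explicit kernel
`P_z(y, ω) = f_e(y) / α_0(z)
  + ∑_{i=1}^n f_{y_i}(y) √(d^i) / α_i(z) [1_{Ω_{y_i}}(ω) - (1/d) 1_{Ω_{y_{i-1}}}(ω)]`, `n = |y|`. -/
def poissonKernel {d : ℕ} (lam bet : ℕ → ℝ) (z : ℂ) (f : Vertex d → L2Tree d)
    (y : Vertex d) (ω : Boundary d) : ℂ :=
  f (root d) y / (alpha d lam bet z 0 : ℂ)
    + ∑ i ∈ Finset.Icc 1 y.length,
      f (pathTo y i) y / (alpha d lam bet z i : ℂ) * (√((d : ℝ) ^ i) : ℂ)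
        * ((cylinder (pathTo y i)).indicator 1 ω
          - 1 / (d : ℂ) * (cylinder (pathTo y (i - 1))).indicator 1 ω)

end JacobiTree

end

open JacobiTree

noncomputable section

namespace JacobiTree

/-! The deficiency space consists of the square-summable solutions of `Jv = zv` on the tree
(`mem_deficiencySpace_jacobi_iff`). The central observation is `levelSum_eq`: if a solution `v`
vanishes at the predecessor of `x` (or `x` is the root), then its sums over the levels of `Γ_x`,
divided by `√d ^ n`, satisfy the three-term recurrence with off-diagonal entries `√d λ_n`. They are
therefore `v x` times a fundamental solution, whose squared `ℓ²` norm is `α_{|x|}(z)²`.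

This has two consequences. First, since `J` is not essentially selfadjoint and has real
coefficients, `N_z(J)` contains some `v ≠ 0`; Cauchy–Schwarz on the levels makes one fundamental
solution square summable, and Weyl's limit circle argument (`IsThreeTermSolution.summable_sq`)
extends this to all of them. So every `α_k(z)` is finite and the `f_x` exist. Second, the inner
product of `f_x` with such a `v` is `α_{|x|}(z)² v(x)` (`inner_radialVector`). A solution orthogonal
to `f_e` and to all zero-sum combinations of sibling functions `f_{x_i}` therefore vanishes, by
induction down the tree.

The orthogonality relations of the normalized `f_x` have the same combinatorial form as those of the
normalized indicators of cylinders; this form is isolated in `IsTreeSystem`. In both spaces the root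
vector and the zero-sum combinations of siblings yield a Hilbert basis with the same index set, and
`U` matches the two bases. Uniqueness holds because these vectors are total.

For the kernel, evaluation of `UF` at `y` and integration against the explicit kernel are both
bounded functionals of `F`, so they need only be compared on the basis. There at most one bracket of
the kernel contributes (`integral_poissonKernel_mul_wavelet`). -/

/-- The equations of the infinite Jacobi matrix with off-diagonal entries `c` and diagonal `b`,
at all rows but the first. -/
def IsThreeTermSolution (c b : ℕ → ℝ) (z : ℂ) (t : ℕ → ℂ) : Prop :=
  ∀ n, z * t (n + 1) = c n * t n + b (n + 1) * t (n + 1) + c (n + 1) * t (n + 2)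

/-! ### Three-term recurrences: Green's formula and the limit circle case. -/

namespace IsThreeTermSolution

variable {c b : ℕ → ℝ} {z : ℂ} {t s : ℕ → ℂ}

theorem add_mul (ht : IsThreeTermSolution c b z t) (hs : IsThreeTermSolution c b z s) (m : ℂ) :
    IsThreeTermSolution c b z (fun n => t n + m * s n) := fun n => by
  linear_combination ht n + m * hs n

theorem const_mul (ht : IsThreeTermSolution c b z t) (m : ℂ) :
    IsThreeTermSolution c b z (fun n => m * t n) := fun n => by
  linear_combination m * ht n

theorem shift (ht : IsThreeTermSolution c b z t) (k : ℕ) :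
    IsThreeTermSolution (fun n => c (k + n)) (fun n => b (k + n)) z (fun n => t (k + n)) :=
  fun n => ht (k + n)

theorem ext (hc : ∀ n, 0 < c n) (ht : IsThreeTermSolution c b z t)
    (hs : IsThreeTermSolution c b z s) (h0 : t 0 = s 0) (h1 : t 1 = s 1) (n : ℕ) : t n = s n := by
  have : t n = s n ∧ t (n + 1) = s (n + 1) := by
    induction n with
    | zero => exact ⟨h0, h1⟩
    | succ n ih =>
      refine ⟨ih.2, ?_⟩
      have hcn : (c (n + 1) : ℂ) ≠ 0 := by exact_mod_cast (hc (n + 1)).ne'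
      refine mul_left_cancel₀ hcn ?_
      have h1 := ht n
      have h2 := hs n
      rw [ih.1, ih.2] at h1
      show (c (n + 1) : ℂ) * t (n + 2) = c (n + 1) * s (n + 2)
      linear_combination h2 - h1
  exact this.1

/-- The imaginary part of Green's formula. -/
theorem green (ht : IsThreeTermSolution c b z t) (n : ℕ) :
    z.im * ∑ j ∈ Finset.range n, ‖t (j + 1)‖ ^ 2 =
      c n * (t (n + 1) * conj (t n)).im - c 0 * (t 1 * conj (t 0)).im := by
  induction n with
  | zero => simp
  | succ n ih =>
    rw [Finset.sum_range_succ, mul_add, ih]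
    have h := congrArg (fun w : ℂ => (w * conj (t (n + 1))).im) (ht n)
    simp only [Complex.add_im, Complex.mul_im, Complex.mul_re, Complex.add_re, Complex.ofReal_re,
      Complex.ofReal_im, Complex.conj_re, Complex.conj_im] at h ⊢
    rw [Complex.sq_norm, Complex.normSq_apply]
    linear_combination h

/-- At a zero of `s` both boundary terms of Green's formula vanish, so the sum of the `‖s j‖ ^ 2` in
between is zero, against `s 1 = 1`. In other words, a finite Hermitian Jacobi matrix has no nonreal
eigenvalue. -/
theorem ne_zero (hz : z.im ≠ 0) (hs : IsThreeTermSolution c b z s) (h0 : s 0 = 0) (h1 : s 1 = 1)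
    (n : ℕ) : s (n + 1) ≠ 0 := by
  intro h
  rcases n with _ | n
  · simp [h1] at h
  have hg := hs.green (n + 1)
  rw [h, h0] at hg
  simp only [zero_mul, map_zero, mul_zero, Complex.zero_im, sub_zero, mul_eq_zero, hz,
    false_or] at hg
  have := (Finset.sum_eq_zero_iff_of_nonneg (fun _ _ => by positivity)).1 hg 0 (by simp)
  simp [h1] at this

/-- In the limit circle case all solutions are square summable. -/
theorem summable_sq (hc : ∀ n, 0 < c n) (hz : z.im ≠ 0) (hs : IsThreeTermSolution c b z s)
    (h0 : s 0 = 0) (h1 : s 1 = 1) (hsum : Summable fun n => ‖s n‖ ^ 2)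
    (ht : IsThreeTermSolution c b z t) : Summable fun n => ‖t n‖ ^ 2 := by
  have hzpos : 0 < |z.im| := abs_pos.2 hz
  set C : ℝ := c 0 * ‖t 0‖ / |z.im| with hC
  have hC0 : 0 ≤ C := by have := (hc 0).le; positivity
  set S : ℝ := ∑' n, ‖s n‖ ^ 2
  refine (summable_nat_add_iff 1).1 ?_
  refine summable_of_sum_range_le (c := 2 * (C * C) + 2 * ((C + ‖t 1‖) ^ 2 * S))
    (fun n => by positivity) fun n => ?_
  rcases n with _ | n
  · have : 0 ≤ S := tsum_nonneg fun n => by positivity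
    simp only [Finset.range_zero, Finset.sum_empty]
    positivity
  -- Weyl's argument: this `m` makes `t + m s` vanish at `n + 2`, which removes the far boundary
  -- term in Green's formula. The near term gives a bound `C * ‖u 0‖` with `C` independent of `n`;
  -- hence `‖u 0‖ ≤ C`, and `m = u 0 - t 1` stays bounded as `n` grows.
  set m : ℂ := -t (n + 2) / s (n + 2) with hm
  have hu := ht.add_mul hs m
  have hun : t (n + 2) + m * s (n + 2) = 0 := by
    rw [hm, div_mul_cancel₀ _ (hs.ne_zero hz h0 h1 (n + 1))]; ring
  have hg := hu.green (n + 1)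
  simp only [h0, h1, mul_zero, mul_one, add_zero] at hg
  rw [show n + 1 + 1 = n + 2 from rfl, hun] at hg
  simp only [zero_mul, Complex.zero_im, mul_zero, zero_sub] at hg
  set u : ℕ → ℂ := fun j => t (j + 1) + m * s (j + 1) with hudef
  have hsumnn : 0 ≤ ∑ j ∈ Finset.range (n + 1), ‖u j‖ ^ 2 :=
    Finset.sum_nonneg fun _ _ => by positivity
  have hle : ∑ j ∈ Finset.range (n + 1), ‖u j‖ ^ 2 ≤ C * ‖u 0‖ := by
    have h2 : |z.im| * ∑ j ∈ Finset.range (n + 1), ‖u j‖ ^ 2 ≤ c 0 * (‖u 0‖ * ‖t 0‖) := by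
      rw [← abs_of_nonneg hsumnn, ← abs_mul, hg, abs_neg, abs_mul, abs_of_pos (hc 0)]
      refine mul_le_mul_of_nonneg_left ?_ (hc 0).le
      refine (Complex.abs_im_le_norm _).trans ?_
      rw [norm_mul, RCLike.norm_conj]
      simp [hudef, h1]
    rw [hC, div_mul_eq_mul_div, le_div_iff₀ hzpos]
    linarith
  have hu0 : ‖u 0‖ ≤ C := by
    by_contra! hlt
    have h3 : ‖u 0‖ ^ 2 ≤ C * ‖u 0‖ :=
      (Finset.single_le_sum (f := fun j => ‖u j‖ ^ 2) (fun _ _ => by positivity)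
        (Finset.mem_range.2 n.succ_pos)).trans hle
    nlinarith
  have hmle : ‖m‖ ≤ C + ‖t 1‖ := by
    have : m = u 0 - t 1 := by simp [hudef, h1]
    rw [this]
    exact (norm_sub_le _ _).trans (by linarith)
  have hS : ∑ j ∈ Finset.range (n + 1), ‖s (j + 1)‖ ^ 2 ≤ S := by
    have := hsum.sum_le_tsum (Finset.range (n + 1 + 1)) (fun _ _ => by positivity)
    rw [Finset.sum_range_succ'] at this
    simpa [h0] using this
  calc ∑ j ∈ Finset.range (n + 1), ‖t (j + 1)‖ ^ 2
      ≤ ∑ j ∈ Finset.range (n + 1), (2 * ‖u j‖ ^ 2 + 2 * (‖m‖ ^ 2 * ‖s (j + 1)‖ ^ 2)) := by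
        refine Finset.sum_le_sum fun j _ => ?_
        have h4 : ‖t (j + 1)‖ ≤ ‖u j‖ + ‖m‖ * ‖s (j + 1)‖ := by
          rw [← norm_mul]
          have : t (j + 1) = u j - m * s (j + 1) := by simp [hudef]
          rw [this]
          exact norm_sub_le _ _
        nlinarith [norm_nonneg (t (j + 1)), sq_nonneg (‖u j‖ - ‖m‖ * ‖s (j + 1)‖)]
    _ = 2 * ∑ j ∈ Finset.range (n + 1), ‖u j‖ ^ 2
        + 2 * (‖m‖ ^ 2 * ∑ j ∈ Finset.range (n + 1), ‖s (j + 1)‖ ^ 2) := by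
        rw [Finset.sum_add_distrib, Finset.mul_sum, Finset.mul_sum, Finset.mul_sum]
    _ ≤ 2 * (C * C) + 2 * ((C + ‖t 1‖) ^ 2 * S) := by
        have h5 : C * ‖u 0‖ ≤ C * C := mul_le_mul_of_nonneg_left hu0 hC0
        have h6 : ‖m‖ ^ 2 ≤ (C + ‖t 1‖) ^ 2 := pow_le_pow_left₀ (norm_nonneg _) hmle 2
        have h7 : ‖m‖ ^ 2 * ∑ j ∈ Finset.range (n + 1), ‖s (j + 1)‖ ^ 2
            ≤ (C + ‖t 1‖) ^ 2 * S :=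
          mul_le_mul h6 hS (Finset.sum_nonneg fun _ _ => by positivity) (by positivity)
        linarith

end IsThreeTermSolution

/-! ### Essential selfadjointness and deficiency spaces -/

section Operator

variable {H : Type*} [NormedAddCommGroup H] [InnerProductSpace ℂ H] {T : H →ₗ.[ℂ] H} {z : ℂ}

theorem mem_deficiencySpace_iff {v : H} :
    v ∈ deficiencySpace T z ↔ ∀ x : T.domain, inner ℂ (T x - conj z • (x : H)) v = 0 := by
  rw [deficiencySpace, Submodule.mem_orthogonal]
  constructor
  · exact fun h x => h _ ⟨x, rfl⟩
  · rintro h _ ⟨x, rfl⟩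
    exact h x

/-- The inner product of `x` with `T x` is real, so that of `x` with `T x - z • x` has imaginary
part `-(z.im * ‖x‖ ^ 2)`; then apply Cauchy–Schwarz. -/
theorem _root_.LinearPMap.IsFormalAdjoint.norm_le (hT : T.IsFormalAdjoint T) (z : ℂ)
    (x : T.domain) : |z.im| * ‖x‖ ≤ ‖T x - z • (x : H)‖ := by
  have h0 : (inner ℂ (x : H) (T x)).im = 0 := by
    have h1 := hT x x
    have h2 := inner_conj_symm (𝕜 := ℂ) (x : H) (T x)
    rw [h1] at h2
    exact Complex.conj_eq_iff_im.1 h2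
  have h1 : (inner ℂ (x : H) (T x - z • (x : H))).im = -(z.im * ‖x‖ ^ 2) := by
    rw [inner_sub_right, inner_smul_right, inner_self_eq_norm_sq_to_K, Complex.sub_im, h0]
    simp [← Complex.ofReal_pow]
  have h2 : |z.im| * ‖x‖ ^ 2 ≤ ‖x‖ * ‖T x - z • (x : H)‖ := by
    have h3 := (Complex.abs_im_le_norm _).trans (norm_inner_le_norm (𝕜 := ℂ) (x : H)
      (T x - z • (x : H)))
    rwa [h1, abs_neg, abs_mul, abs_of_nonneg (sq_nonneg ‖x‖)] at h3
  rcases (norm_nonneg x).eq_or_lt with h | h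
  · rw [← h]; simp
  · nlinarith

variable [CompleteSpace H]

/-- Membership in the graph of the adjoint is a condition on pairs of the graph of `T` that is
closed in the pair, so it passes to the closure of the graph. -/
theorem graph_closure_adjoint (hd : Dense (T.domain : Set H)) (hT : T.IsClosable) :
    LinearPMap.adjoint T.closure = LinearPMap.adjoint T := by
  have hd' : Dense (T.closure.domain : Set H) := hd.mono T.le_closure.1
  refine LinearPMap.eq_of_eq_graph ?_
  rw [LinearPMap.adjoint_graph_eq_graph_adjoint hd, LinearPMap.adjoint_graph_eq_graph_adjoint hd',
    ← hT.graph_closure_eq_closure_graph]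
  ext x
  rw [Submodule.mem_adjoint_iff, Submodule.mem_adjoint_iff]
  refine ⟨fun h a b hab => h a b (Submodule.le_topologicalClosure _ hab), fun h a b hab => ?_⟩
  have hc : IsClosed {w : H × H | inner ℂ w.2 x.1 - inner ℂ w.1 x.2 = 0} :=
    isClosed_eq (by fun_prop) continuous_const
  exact closure_minimal (s := (T.graph : Set (H × H))) (fun w hw => h w.1 w.2 hw) hc hab

/-- Surjectivity of the closure of `T - z`: the range of `T - z` is dense because its orthogonal
complement is the deficiency space at `conj z`, and the lower bound `norm_le` turns convergent
images into Cauchy preimages. -/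
theorem exists_mem_closure_graph (hT : T.IsFormalAdjoint T) (hz : z.im ≠ 0)
    (h : deficiencySpace T (conj z) = ⊥) (w : H) :
    ∃ x, (x, w + z • x) ∈ T.graph.topologicalClosure := by
  have hzpos : 0 < |z.im| := abs_pos.2 hz
  have hw : w ∈ (LinearMap.range (T.toFun - z • T.domain.subtype)).topologicalClosure := by
    rw [deficiencySpace, Complex.conj_conj] at h
    rw [Submodule.topologicalClosure_eq_top_iff.2 h]
    trivial
  obtain ⟨y, hy, hlim⟩ := mem_closure_iff_seq_limit.1 hw
  choose u hu using hy
  have hu' : ∀ n, T (u n) = y n + z • (u n : H) := fun n => by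
    rw [← hu n]
    simp
  have hcau : CauchySeq fun n => (u n : H) := by
    rw [Metric.cauchySeq_iff]
    intro ε hε
    obtain ⟨N, hN⟩ := Metric.cauchySeq_iff.1 hlim.cauchySeq (|z.im| * ε) (by positivity)
    refine ⟨N, fun m hm n hn => ?_⟩
    have h1 := hT.norm_le z (u m - u n)
    have h2 := hN m hm n hn
    rw [LinearPMap.map_sub, hu', hu'] at h1
    rw [dist_eq_norm] at h2 ⊢
    have h3 : y m + z • (u m : H) - (y n + z • (u n : H)) - z • ((u m - u n : T.domain) : H)
        = y m - y n := by
      rw [Submodule.coe_sub, smul_sub]; abel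
    rw [h3] at h1
    exact lt_of_mul_lt_mul_left (h1.trans_lt h2) hzpos.le
  obtain ⟨x, hx⟩ := cauchySeq_tendsto_of_complete hcau
  refine ⟨x, mem_closure_of_tendsto (f := fun n => ((u n : H), y n + z • (u n : H)))
    (hx.prodMk_nhds (hlim.add (hx.const_smul z))) (Filter.Eventually.of_forall fun n => ?_)⟩
  rw [← hu']
  exact T.mem_graph (u n)

/-- A symmetric operator whose two deficiency spaces vanish is essentially selfadjoint. -/
theorem isEssentiallySelfAdjoint_of_deficiencySpace_eq_bot (hd : Dense (T.domain : Set H))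
    (hT : T.IsFormalAdjoint T) (hz : z.im ≠ 0) (h : deficiencySpace T z = ⊥)
    (h' : deficiencySpace T (conj z) = ⊥) : IsEssentiallySelfAdjoint T := by
  have hle : T ≤ LinearPMap.adjoint T := hT.le_adjoint hd
  have hcl : (LinearPMap.adjoint T).IsClosed := LinearPMap.adjoint_isClosed hd
  have hTc : T.IsClosable := hcl.isClosable.leIsClosable hle
  rw [IsEssentiallySelfAdjoint, LinearPMap.isSelfAdjoint_def, graph_closure_adjoint hd hTc]
  refine LinearPMap.eq_of_eq_graph ?_
  rw [← hTc.graph_closure_eq_closure_graph]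
  have hsub : T.graph.topologicalClosure ≤ (LinearPMap.adjoint T).graph :=
    Submodule.topologicalClosure_minimal _ (LinearPMap.le_graph_of_le hle) hcl
  refine le_antisymm (fun p hp => ?_) hsub
  obtain ⟨y, w⟩ := p
  -- For `(y, w)` in the graph of the adjoint, choose `x` in the domain of the closure with the same
  -- image under `T* - z`. Then `y - x` lies in the kernel of `T* - z`, which is the deficiency
  -- space at `z` and hence zero.
  obtain ⟨x, hx⟩ := exists_mem_closure_graph hT hz h' (w - z • y)
  have hmem := Submodule.sub_mem _ hp (hsub hx)
  have hzero : y - x ∈ deficiencySpace T z := by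
    rw [LinearPMap.adjoint_graph_eq_graph_adjoint hd, Submodule.mem_adjoint_iff] at hmem
    rw [mem_deficiencySpace_iff]
    intro u
    have := hmem u (T u) (T.mem_graph u)
    have h2 : w - (w - z • y + z • x) = z • (y - x) := by rw [smul_sub]; abel
    simp only [Prod.fst_sub, Prod.snd_sub, h2] at this
    rw [inner_sub_left, inner_smul_left, Complex.conj_conj, ← this, inner_smul_right]
  rw [h, Submodule.mem_bot, sub_eq_zero] at hzero
  subst hzero
  simpa using hx

end Operator

/-! ### The deficiency space of the Jacobi operator -/

section Jacobi

variable {d : ℕ} {lam bet : ℕ → ℝ} {z : ℂ}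

theorem delta_apply (x y : Vertex d) : delta x y = if y = x then 1 else 0 := by
  classical
  rw [delta, lp.single_apply, Pi.single_apply]

theorem inner_delta (x : Vertex d) (v : L2Tree d) : inner ℂ (delta x) v = v x := by
  classical
  rw [delta, lp.inner_single_left]
  simp

theorem inner_jacobiDelta (x : Vertex d) (v : L2Tree d) :
    inner ℂ (jacobiDelta lam bet x) v = jacobiAction lam bet v x := by
  rcases x with _ | ⟨j, x⟩ <;>
  simp [jacobiDelta, jacobiAction, inner_delta]

theorem sum_delta_cons (x y : Vertex d) (j : Fin d) :
    ∑ i : Fin d, delta (j :: y) (i :: x) = if x = y then 1 else 0 := by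
  by_cases h : x = y <;> simp [delta_apply, h]

theorem jacobiAction_delta_comm (x y : Vertex d) :
    jacobiAction lam bet (delta y) x = conj (jacobiAction lam bet (delta x) y) := by
  rcases x with _ | ⟨i, x⟩ <;> rcases y with _ | ⟨j, y⟩
  · simp [jacobiAction, delta_apply]
  · rcases y with _ | ⟨k, y⟩ <;> simp [jacobiAction, delta_apply]
  · rcases x with _ | ⟨k, x⟩ <;> simp [jacobiAction, delta_apply]
  · simp only [jacobiAction, sum_delta_cons]
    simp only [delta_apply]
    by_cases h1 : i :: x = j :: y
    · obtain ⟨rfl, rfl⟩ := List.cons_eq_cons.1 h1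
      simp
    · by_cases h2 : x = j :: y
      · subst h2
        have h3 : ¬ y = i :: j :: y := fun h => by
          have := congrArg List.length h
          simp at this; omega
        simp [h3, Ne.symm h1, Ne.symm h3]
      · by_cases h3 : y = i :: x
        · subst h3
          simp [h2, Ne.symm h1, Ne.symm h2]
        · simp [h1, h2, h3, Ne.symm h1, Ne.symm h2, Ne.symm h3]

theorem jacobiOperator_isFormalAdjoint :
    (jacobiOperator d lam bet).IsFormalAdjoint (jacobiOperator d lam bet) := by
  rintro ⟨x, hx⟩ ⟨y, hy⟩
  have key : ∀ x y : Vertex d, inner ℂ (jacobiDelta lam bet x) (delta y)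
      = inner ℂ (delta x) (jacobiDelta lam bet y) := fun x y => by
    rw [inner_jacobiDelta, jacobiAction_delta_comm, ← inner_conj_symm, inner_jacobiDelta]
  induction hx using Submodule.span_induction with
  | mem x hx =>
    obtain ⟨x, rfl⟩ := hx
    induction hy using Submodule.span_induction with
    | mem y hy =>
      obtain ⟨y, rfl⟩ := hy
      have h1 := jacobiOperator_delta lam bet x
      have h2 := jacobiOperator_delta lam bet y
      exact (congrArg (inner ℂ · (delta y)) h1).trans ((key x y).trans
        (congrArg (inner ℂ (delta x)) h2.symm))
    | zero =>
      exact (inner_zero_right _).trans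
        ((congrArg (inner ℂ (delta x)) (jacobiOperator d lam bet).map_zero).trans
          (inner_zero_right _)).symm
    | add y y' hy hy' h h' =>
      have h1 := (jacobiOperator d lam bet).map_add ⟨y, hy⟩ ⟨y', hy'⟩
      exact (inner_add_right _ _ _).trans ((congrArg₂ (· + ·) h h').trans
        ((inner_add_right _ _ _).symm.trans (congrArg (inner ℂ (delta x)) h1.symm)))
    | smul a y hy h =>
      have h1 := (jacobiOperator d lam bet).map_smul a ⟨y, hy⟩
      exact (inner_smul_right _ _ _).trans ((congrArg (a * ·) h).trans
        ((inner_smul_right _ _ _).symm.trans (congrArg (inner ℂ (delta x)) h1.symm)))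
  | zero =>
    exact ((congrArg (inner ℂ · y) (jacobiOperator d lam bet).map_zero).trans
      (inner_zero_left _)).trans (inner_zero_left _).symm
  | add x x' hx hx' h h' =>
    have h1 := (jacobiOperator d lam bet).map_add ⟨x, hx⟩ ⟨x', hx'⟩
    exact ((congrArg (inner ℂ · y) h1).trans (inner_add_left _ _ _)).trans
      ((congrArg₂ (· + ·) h h').trans (inner_add_left _ _ _).symm)
  | smul a x hx h =>
    have h1 := (jacobiOperator d lam bet).map_smul a ⟨x, hx⟩
    exact ((congrArg (inner ℂ · y) h1).trans (inner_smul_left _ _ _)).trans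
      ((congrArg (conj a * ·) h).trans (inner_smul_left _ _ _).symm)

theorem dense_jacobiOperator_domain : Dense ((jacobiOperator d lam bet).domain : Set (L2Tree d)) := by
  rw [Submodule.dense_iff_topologicalClosure_eq_top, Submodule.topologicalClosure_eq_top_iff,
    Submodule.eq_bot_iff]
  intro v hv
  ext x
  have := (Submodule.mem_orthogonal _ _).1 hv (delta x) (delta_mem_domain lam bet x)
  rwa [inner_delta] at this

/-- Orthogonality need only be tested on the images of the `δ_y`. By symmetry of the coefficients
the product of `Jδ_y` with `v` is `(Jv)(y)`, and conjugate linearity in the first argument turns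
`conj z` into `z`. -/
theorem mem_deficiencySpace_jacobi_iff {v : L2Tree d} :
    v ∈ deficiencySpace (jacobiOperator d lam bet) z ↔
      ∀ y, jacobiAction lam bet v y = z * v y := by
  rw [mem_deficiencySpace_iff]
  have key : ∀ y, inner ℂ (jacobiOperator d lam bet ⟨delta y, delta_mem_domain lam bet y⟩
      - conj z • delta y) v = jacobiAction lam bet v y - z * v y := fun y => by
    rw [jacobiOperator_delta, inner_sub_left, inner_smul_left, inner_jacobiDelta, inner_delta,
      Complex.conj_conj]
  constructor
  · intro h y
    rw [← sub_eq_zero, ← key]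
    exact h _
  · rintro h ⟨x, hx⟩
    induction hx using Submodule.span_induction with
    | mem x hx =>
      obtain ⟨y, rfl⟩ := hx
      exact (key y).trans (sub_eq_zero.2 (h y))
    | zero =>
      have h1 := (jacobiOperator d lam bet).map_zero
      refine (congrArg (fun w => inner ℂ (w - conj z • (0 : L2Tree d)) v) h1).trans ?_
      simp
    | add x x' hx hx' h h' =>
      have h1 := (jacobiOperator d lam bet).map_add ⟨x, hx⟩ ⟨x', hx'⟩
      refine (congrArg (fun w => inner ℂ (w - conj z • (x + x')) v) h1).trans ?_
      rw [smul_add, add_sub_add_comm, inner_add_left]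
      exact (congrArg₂ (· + ·) h h').trans (add_zero 0)
    | smul a x hx h =>
      have h1 := (jacobiOperator d lam bet).map_smul a ⟨x, hx⟩
      refine (congrArg (fun w => inner ℂ (w - conj z • (a • x)) v) h1).trans ?_
      rw [smul_comm, ← smul_sub, inner_smul_left]
      exact (congrArg (conj a * ·) h).trans (mul_zero _)

theorem jacobiAction_star (v : L2Tree d) (y : Vertex d) :
    jacobiAction lam bet (star v : L2Tree d) y = conj (jacobiAction lam bet v y) := by
  rcases y with _ | ⟨j, y⟩ <;> simp [jacobiAction]

/-- The coefficients of `J` are real, so complex conjugation exchanges the deficiency spaces at `z`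
and `conj z`. One trivial deficiency space therefore already forces essential selfadjointness. -/
theorem deficiencySpace_conj_eq_bot (h : deficiencySpace (jacobiOperator d lam bet) z = ⊥) :
    deficiencySpace (jacobiOperator d lam bet) (conj z) = ⊥ := by
  rw [Submodule.eq_bot_iff] at h ⊢
  intro v hv
  rw [mem_deficiencySpace_jacobi_iff] at hv
  refine star_eq_zero.1 (h _ (mem_deficiencySpace_jacobi_iff.2 fun y => ?_))
  rw [jacobiAction_star, hv]
  simp

theorem deficiencySpace_ne_bot (hJ : ¬ IsEssentiallySelfAdjoint (jacobiOperator d lam bet))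
    (hz : z.im ≠ 0) : deficiencySpace (jacobiOperator d lam bet) z ≠ ⊥ := fun h =>
  hJ (isEssentiallySelfAdjoint_of_deficiencySpace_eq_bot dense_jacobiOperator_domain
    jacobiOperator_isFormalAdjoint hz h (deficiencySpace_conj_eq_bot h))

end Jacobi

/-! ### Sums over the levels of a subtree -/

section LevelSum

variable {d : ℕ} {E : Type*}

/-- The sum of `g` over the vertices of `Γ_x` that have distance `n` from `x`. -/
def levelSum [AddCommMonoid E] (n : ℕ) (g : Vertex d → E) (x : Vertex d) : E :=
  ∑ w : List.Vector (Fin d) n, g (w.1 ++ x)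

/-- A word is a length together with a word of that length. -/
def levelEquiv : (Σ n, List.Vector (Fin d) n) ≃ Vertex d :=
  Equiv.sigmaFiberEquiv List.length

theorem levelSum_zero [AddCommMonoid E] (g : Vertex d → E) (x : Vertex d) :
    levelSum 0 g x = g x := by
  rw [levelSum, Fintype.sum_subsingleton _ List.Vector.nil]
  rfl

theorem levelSum_succ [AddCommMonoid E] (n : ℕ) (g : Vertex d → E) (x : Vertex d) :
    levelSum (n + 1) g x = ∑ w : List.Vector (Fin d) n, ∑ i, g (i :: (w.1 ++ x)) := by
  rw [← Fintype.sum_prod_type', levelSum]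
  symm
  refine Fintype.sum_bijective (fun p : List.Vector (Fin d) n × Fin d => p.2 ::ᵥ p.1) ⟨?_, ?_⟩ _ _
    fun _ => rfl
  · rintro ⟨w, i⟩ ⟨w', i'⟩ h
    obtain ⟨h1, h2⟩ := List.cons_eq_cons.1 (congrArg Subtype.val h)
    exact Prod.ext (Subtype.ext h2) h1
  · exact fun w => ⟨(w.tail, w.head), w.cons_head_tail⟩

theorem levelSum_of_forall_eq [Semiring E] {n : ℕ} {g : Vertex d → E} {x : Vertex d} {a : E}
    (h : ∀ w : Vertex d, w.length = n → g (w ++ x) = a) : levelSum n g x = (d : E) ^ n * a := by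
  rw [levelSum, Finset.sum_congr rfl fun w _ => h w.1 w.2]
  simp [card_vector]

theorem norm_levelSum_sq_le (n : ℕ) (g : Vertex d → ℂ) (x : Vertex d) :
    ‖levelSum n g x‖ ^ 2 ≤ (d : ℝ) ^ n * levelSum n (fun y => ‖g y‖ ^ 2) x := by
  calc ‖levelSum n g x‖ ^ 2 ≤ (∑ w : List.Vector (Fin d) n, ‖g (w.1 ++ x)‖) ^ 2 :=
        pow_le_pow_left₀ (norm_nonneg _) (norm_sum_le _ _) 2
    _ ≤ _ := by
        refine (sq_sum_le_card_mul_sum_sq).trans_eq ?_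
        simp [card_vector, levelSum]

theorem summable_levelSum [NormedAddCommGroup E] [CompleteSpace E] {g : Vertex d → E}
    (hg : Summable g) (x : Vertex d) : Summable fun n => levelSum n g x := by
  have h1 : Summable fun w : Vertex d => g (w ++ x) :=
    hg.comp_injective (List.append_left_injective x)
  have h2 := levelEquiv.summable_iff.2 h1
  exact (h2.hasSum.sigma fun n => hasSum_fintype _).summable

theorem hasSum_append_of_eq_zero [NormedAddCommGroup E] {g : Vertex d → E} {x : Vertex d} {a : E}
    (h0 : ∀ y ∉ subtree x, g y = 0) : HasSum (fun w => g (w ++ x)) a ↔ HasSum g a :=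
  (List.append_left_injective x).hasSum_iff fun y hy => h0 y fun ⟨w, hw⟩ => hy ⟨w, hw⟩

theorem hasSum_levelSum [NormedAddCommGroup E] [CompleteSpace E] {g : Vertex d → E}
    {x : Vertex d} {a : E} (hg : HasSum g a) (h0 : ∀ y ∉ subtree x, g y = 0) :
    HasSum (fun n => levelSum n g x) a := by
  have h1 := (hasSum_append_of_eq_zero h0).2 hg
  have h2 := levelEquiv.hasSum_iff.2 h1
  exact h2.sigma fun n => hasSum_fintype _

theorem summable_of_summable_levelSum {g : Vertex d → ℝ} {x : Vertex d} (hg : ∀ y, 0 ≤ g y)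
    (h0 : ∀ y ∉ subtree x, g y = 0) (h : Summable fun n => levelSum n g x) : Summable g := by
  have h2 : Summable ((fun w => g (w ++ x)) ∘ levelEquiv) := by
    refine (summable_sigma_of_nonneg fun _ => hg _).2 ⟨fun n => Summable.of_finite, h.congr fun n => ?_⟩
    rw [tsum_fintype]
    rfl
  obtain ⟨a, ha⟩ := levelEquiv.summable_iff.1 h2
  exact ⟨a, (hasSum_append_of_eq_zero h0).1 ha⟩

end LevelSum

theorem summable_norm_sq {ι : Type*} (v : ℓ²(ι, ℂ)) : Summable fun i => ‖v i‖ ^ 2 := by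
  simpa using (lp.memℓp v).summable (by simp)

/-! ### Solutions of the recurrence, extended by one term to the left -/

/-- The sequence `1, λ_0, λ_1, …`. -/
def extLam (lam : ℕ → ℝ) : ℕ → ℝ
  | 0 => 1
  | n + 1 => lam n

/-- The sequence `0, β_0, β_1, …`. -/
def extBet (bet : ℕ → ℝ) : ℕ → ℝ
  | 0 => 0
  | n + 1 => bet n

/-- The sequence `0, p_0, p_1, …`. -/
def extP (d : ℕ) (lam bet : ℕ → ℝ) (z : ℂ) : ℕ → ℂ
  | 0 => 0
  | n + 1 => polyP d lam bet z n

/-- The sequence `-1, q_0, q_1, …`. -/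
def extQ (d : ℕ) (lam bet : ℕ → ℝ) (z : ℂ) : ℕ → ℂ
  | 0 => -1
  | n + 1 => polyQ d lam bet z n

/-- The value of `v` at the predecessor, and `0` at the root. -/
def parentValue {d : ℕ} (v : Vertex d → ℂ) : Vertex d → ℂ
  | [] => 0
  | _ :: x => v x

/-- The solution of the recurrence that vanishes at `k` and has the value `1` at `k + 1`, for the
extended sequences. -/
def fundamentalSolution (d : ℕ) (lam bet : ℕ → ℝ) (z : ℂ) (k n : ℕ) : ℂ :=
  extLam lam k * (extP d lam bet z k * extQ d lam bet z n - extQ d lam bet z k * extP d lam bet z n)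

/-- The value of `√(d^n) f_x` at distance `n` from `x`, where `|x| = k`. -/
def radialCoeff (d : ℕ) (lam bet : ℕ → ℝ) (z : ℂ) (k n : ℕ) : ℂ :=
  fundamentalSolution d lam bet z k (k + (n + 1))

section Radial

variable {d : ℕ} {lam bet : ℕ → ℝ} {z : ℂ}

theorem jacobiAction_eq (v : Vertex d → ℂ) (y : Vertex d) :
    jacobiAction lam bet v y = extLam lam y.length * parentValue v y + bet y.length * v y
      + lam y.length * ∑ i, v (i :: y) := by
  rcases y with _ | ⟨i, y⟩ <;> simp [jacobiAction, parentValue, extLam]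

theorem extLam_pos (hlam : ∀ n, 0 < lam n) (n : ℕ) : 0 < extLam lam n := by
  rcases n with _ | n
  · exact one_pos
  · exact hlam n

theorem sqrt_mul_extLam_pos [NeZero d] (hlam : ∀ n, 0 < lam n) (n : ℕ) :
    0 < √(d : ℝ) * extLam lam n :=
  mul_pos (Real.sqrt_pos.2 (by exact_mod_cast NeZero.pos d)) (extLam_pos hlam n)

theorem isThreeTermSolution_extP [NeZero d] (hlam : ∀ n, 0 < lam n) :
    IsThreeTermSolution (fun n => √(d : ℝ) * extLam lam n) (extBet bet) z (extP d lam bet z) := by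
  intro n
  have h : ∀ n, ((√(d : ℝ) * lam n : ℝ) : ℂ) ≠ 0 := fun n => by
    exact_mod_cast (sqrt_mul_extLam_pos (d := d) hlam (n + 1)).ne'
  rcases n with _ | n
  · simp only [extP, extBet, extLam, polyP]
    rw [mul_div_cancel₀ _ (h 0)]
    ring
  · simp only [extP, extBet, extLam, polyP]
    rw [mul_div_cancel₀ _ (h _)]
    ring

/-- The added left terms make the recurrence hold at row `0` as well: there `q_0 = 0`, and `√d * 1 *
(-1)` cancels `√d λ_0 q_1 = √d`. This lets `k = 0` be treated like every other `k`. -/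
theorem isThreeTermSolution_extQ [NeZero d] (hlam : ∀ n, 0 < lam n) :
    IsThreeTermSolution (fun n => √(d : ℝ) * extLam lam n) (extBet bet) z (extQ d lam bet z) := by
  intro n
  have h : ∀ n, ((√(d : ℝ) * lam n : ℝ) : ℂ) ≠ 0 := fun n => by
    exact_mod_cast (sqrt_mul_extLam_pos (d := d) hlam (n + 1)).ne'
  rcases n with _ | n
  · have h0 : (lam 0 : ℂ) ≠ 0 := by exact_mod_cast (hlam 0).ne'
    simp only [extQ, extBet, extLam, polyQ]
    push_cast
    field_simp
    ring
  · simp only [extQ, extBet, extLam, polyQ]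
    rw [mul_div_cancel₀ _ (h _)]
    ring

theorem isThreeTermSolution_fundamentalSolution [NeZero d] (hlam : ∀ n, 0 < lam n) (k : ℕ) :
    IsThreeTermSolution (fun n => √(d : ℝ) * extLam lam n) (extBet bet) z
      (fundamentalSolution d lam bet z k) := by
  intro n
  simp only [fundamentalSolution]
  linear_combination extLam lam k * (extP d lam bet z k * isThreeTermSolution_extQ (d := d) hlam n
    - extQ d lam bet z k * isThreeTermSolution_extP (d := d) hlam n)

theorem fundamentalSolution_self (k : ℕ) : fundamentalSolution d lam bet z k k = 0 := by
  rw [fundamentalSolution]; ring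

/-- This is the constancy of the Casoratian of `p` and `q`, weighted by the off-diagonal entries.
Its initial value is `1` by the choice of the terms added on the left. -/
theorem fundamentalSolution_succ [NeZero d] (hlam : ∀ n, 0 < lam n) (k : ℕ) :
    fundamentalSolution d lam bet z k (k + 1) = 1 := by
  induction k with
  | zero => simp [fundamentalSolution, extP, extQ, extLam, polyP]
  | succ k ih =>
    have h1 := isThreeTermSolution_extP (bet := bet) (z := z) (d := d) hlam k
    have h2 := isThreeTermSolution_extQ (bet := bet) (z := z) (d := d) hlam k
    have hd : ((√(d : ℝ) : ℝ) : ℂ) ≠ 0 := by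
      exact_mod_cast (Real.sqrt_pos.2 (by exact_mod_cast NeZero.pos d : (0 : ℝ) < d)).ne'
    refine mul_left_cancel₀ hd ?_
    rw [← ih]
    simp only [fundamentalSolution]
    push_cast at h1 h2
    rw [show k + 1 + 1 = k + 2 from rfl]
    linear_combination extQ d lam bet z (k + 1) * h1 - extP d lam bet z (k + 1) * h2

theorem radialCoeff_zero [NeZero d] (hlam : ∀ n, 0 < lam n) (k : ℕ) :
    radialCoeff d lam bet z k 0 = 1 :=
  fundamentalSolution_succ hlam k

theorem norm_radialCoeff_sq (k n : ℕ) :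
    ‖radialCoeff d lam bet z k n‖ ^ 2 = alphaTerm d lam bet z k n := by
  rcases k with _ | k
  · simp [radialCoeff, fundamentalSolution, extLam, extP, extQ, alphaTerm]
  · simp [radialCoeff, fundamentalSolution, extLam, extP, extQ, alphaTerm, mul_pow]

/-- The level sums of a solution on `Γ_x` are multiples of the fundamental solution. -/
theorem levelSum_eq [NeZero d] (hlam : ∀ n, 0 < lam n) {v : Vertex d → ℂ} {x : Vertex d}
    (hv : ∀ y ∈ subtree x, jacobiAction lam bet v y = z * v y) (hx : parentValue v x = 0) (n : ℕ) :
    levelSum n v x = ((√(d : ℝ) : ℝ) : ℂ) ^ n * (v x * radialCoeff d lam bet z x.length n) := by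
  set r : ℂ := ((√(d : ℝ) : ℝ) : ℂ) with hr
  have hr0 : r ≠ 0 := by
    rw [hr]
    exact_mod_cast (Real.sqrt_pos.2 (by exact_mod_cast NeZero.pos d : (0 : ℝ) < d)).ne'
  have hrd : r * r = d := by
    rw [hr, ← Complex.ofReal_mul, Real.mul_self_sqrt (by positivity)]
    simp
  -- Sum the equation for `v` over a level. Each vertex of the level above is the predecessor of `d`
  -- vertices, whence the factor `d` on that side only.
  have hrec : ∀ n, z * levelSum (n + 1) v x = d * (lam (x.length + n) * levelSum n v x)
      + bet (x.length + n + 1) * levelSum (n + 1) v x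
      + lam (x.length + n + 1) * levelSum (n + 2) v x := fun n => by
    have hterm : ∀ w : List.Vector (Fin d) (n + 1), z * v (w.1 ++ x) =
        lam (x.length + n) * parentValue v (w.1 ++ x) + bet (x.length + n + 1) * v (w.1 ++ x)
        + lam (x.length + n + 1) * ∑ i, v (i :: (w.1 ++ x)) := fun w => by
      have hlen : (w.1 ++ x).length = x.length + n + 1 := by
        rw [List.length_append, w.2]; omega
      rw [← hv _ ⟨w.1, rfl⟩, jacobiAction_eq, hlen]
      rfl
    have hsum : levelSum (n + 1) (parentValue v) x = d * levelSum n v x := by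
      rw [levelSum_succ, levelSum, Finset.mul_sum]
      simp [parentValue]
    rw [levelSum_succ (n + 1)]
    rw [mul_left_comm, ← hsum]
    simp only [levelSum, Finset.mul_sum]
    rw [← Finset.sum_add_distrib, ← Finset.sum_add_distrib]
    refine Finset.sum_congr rfl fun w _ => ?_
    rw [hterm, Finset.mul_sum]
  have hbase : z * v x = bet x.length * v x + lam x.length * levelSum 1 v x := by
    rw [levelSum_succ 0, Fintype.sum_subsingleton _ List.Vector.nil, ← hv x (List.suffix_refl x), jacobiAction_eq, hx]
    simp only [mul_zero, zero_add]
    rfl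
  -- Dividing by `r ^ n` distributes the one-sided factor `d` as `√d` on both sides. The leading `0`
  -- stands for the vanishing value at the predecessor of `x`, so `t` and the fundamental solution
  -- vanish at the same index.
  let t : ℕ → ℂ := fun n => Nat.casesOn n 0 fun n => (r ^ n)⁻¹ * levelSum n v x
  have ht : IsThreeTermSolution (fun n => √(d : ℝ) * extLam lam (x.length + n))
      (fun n => extBet bet (x.length + n)) z t := by
    intro n
    rcases n with _ | n
    · show z * ((r ^ 0)⁻¹ * levelSum 0 v x) = _ * 0 + (bet x.length : ℂ) *
        ((r ^ 0)⁻¹ * levelSum 0 v x) + ((√(d : ℝ) * lam x.length : ℝ) : ℂ) *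
        ((r ^ 1)⁻¹ * levelSum 1 v x)
      simp only [levelSum_zero, Complex.ofReal_mul, ← hr]
      field_simp
      linear_combination hbase
    · show z * ((r ^ (n + 1))⁻¹ * levelSum (n + 1) v x) =
        ((√(d : ℝ) * lam (x.length + n) : ℝ) : ℂ) * ((r ^ n)⁻¹ * levelSum n v x)
        + (bet (x.length + n + 1) : ℂ) * ((r ^ (n + 1))⁻¹ * levelSum (n + 1) v x)
        + ((√(d : ℝ) * lam (x.length + n + 1) : ℝ) : ℂ) * ((r ^ (n + 2))⁻¹ * levelSum (n + 2) v x)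
      rw [Complex.ofReal_mul, Complex.ofReal_mul, ← hr]
      have h3 := hrec n
      rw [← hrd] at h3
      have hrn : r ^ n ≠ 0 := pow_ne_zero _ hr0
      rw [pow_succ, pow_add]
      field_simp
      linear_combination h3
  have hs := ((isThreeTermSolution_fundamentalSolution (bet := bet) (z := z) (d := d) hlam
    x.length).shift x.length).const_mul (v x)
  have := ht.ext (fun n => sqrt_mul_extLam_pos hlam _) hs
    (by simp [t, fundamentalSolution_self])
    (by simp [t, fundamentalSolution_succ hlam, levelSum_zero]) (n + 1)
  have h4 : (r ^ n)⁻¹ * levelSum n v x = v x * radialCoeff d lam bet z x.length n := this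
  rw [← h4, mul_inv_cancel_left₀ (pow_ne_zero _ hr0)]

/-- Ascending from a vertex with `v x ≠ 0` must stop, at the latest at the root, where `parentValue`
is `0` by convention. -/
theorem exists_ne_zero_of_parentValue_eq_zero {v : Vertex d → ℂ} (hv : ∃ x, v x ≠ 0) :
    ∃ x, v x ≠ 0 ∧ parentValue v x = 0 := by
  by_contra! h
  obtain ⟨x, hx⟩ := hv
  refine hx ?_
  induction x with
  | nil => exact by_contra fun h0 => h [] h0 rfl
  | cons i x ih =>
    by_contra h0
    exact h _ h0 (by_contra fun h1 => h1 (by_contra fun h2 => h2 (by_contra fun h3 => h3 (ih h3))))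

/-- Cauchy–Schwarz on a level with `d ^ n` vertices: this factor cancels the square of the `√d ^ n`
in `levelSum_eq`, leaving `‖v x‖ ^ 2 * ‖radialCoeff‖ ^ 2` below the mass of `v` on the level. -/
theorem summable_radialCoeff_of_mem [NeZero d] (hlam : ∀ n, 0 < lam n) {v : L2Tree d}
    (hv : v ∈ deficiencySpace (jacobiOperator d lam bet) z) {x : Vertex d} (hvx : v x ≠ 0)
    (hx : parentValue v x = 0) :
    Summable fun n => ‖radialCoeff d lam bet z x.length n‖ ^ 2 := by
  rw [mem_deficiencySpace_jacobi_iff] at hv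
  have h1 := summable_levelSum (summable_norm_sq v) x
  refine Summable.of_nonneg_of_le (fun n => by positivity) (fun n => ?_)
    (h1.mul_left ((‖v x‖ ^ 2)⁻¹))
  have h2 := norm_levelSum_sq_le n v x
  rw [levelSum_eq hlam (fun y _ => hv y) hx, norm_mul, norm_pow, norm_mul, Complex.norm_real,
    Real.norm_of_nonneg (Real.sqrt_nonneg _), mul_pow, ← pow_mul, mul_comm n, pow_mul,
    Real.sq_sqrt (by positivity), mul_pow] at h2
  have hd : (0 : ℝ) < (d : ℝ) ^ n := by have := NeZero.pos d; positivity
  have h3 := le_of_mul_le_mul_left h2 hd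
  rw [inv_mul_eq_div, le_div_iff₀ (by positivity)]
  linarith

theorem summable_radialCoeff [NeZero d] (hlam : ∀ n, 0 < lam n)
    (hJ : ¬ IsEssentiallySelfAdjoint (jacobiOperator d lam bet)) (hz : z.im ≠ 0) (k : ℕ) :
    Summable fun n => ‖radialCoeff d lam bet z k n‖ ^ 2 := by
  obtain ⟨v, hv, hv0⟩ := (Submodule.ne_bot_iff _).1 (deficiencySpace_ne_bot hJ hz)
  obtain ⟨x, hvx, hx⟩ := exists_ne_zero_of_parentValue_eq_zero (v := v) (by
    by_contra! h
    exact hv0 (lp.ext (funext h)))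
  have h1 := summable_radialCoeff_of_mem hlam hv hvx hx
  have hfs := fun k => isThreeTermSolution_fundamentalSolution (bet := bet) (z := z) (d := d) hlam k
  have h2 : Summable fun n => ‖fundamentalSolution d lam bet z x.length (x.length + n)‖ ^ 2 :=
    (summable_nat_add_iff 1).1 h1
  -- Shifting by `|x|` puts the zero of the known square-summable solution at index `0`, as the
  -- limit circle lemma requires; the fundamental solution for any `k` solves the same shifted
  -- recurrence.
  have h3 := ((hfs x.length).shift x.length).summable_sq
    (fun n => sqrt_mul_extLam_pos hlam _) hz (fundamentalSolution_self _)
    (fundamentalSolution_succ hlam _) h2 ((hfs k).shift x.length)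
  have h4 : Summable fun n => ‖fundamentalSolution d lam bet z k n‖ ^ 2 := by
    refine (summable_nat_add_iff x.length).1 (h3.congr fun n => ?_)
    rw [add_comm]
  refine ((summable_nat_add_iff (k + 1)).2 h4).congr fun n => ?_
  rw [radialCoeff, add_comm n, add_assoc, add_comm 1]

end Radial

/-! ### The functions `f_x` -/

section RadialFunction

variable {d : ℕ} {lam bet : ℕ → ℝ} {z : ℂ}

/-- The function `f_x`. -/
def radialFunction (d : ℕ) (lam bet : ℕ → ℝ) (z : ℂ) (x y : Vertex d) : ℂ :=
  if x <:+ y then (((√(d : ℝ) : ℝ) : ℂ) ^ (y.length - x.length))⁻¹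
    * radialCoeff d lam bet z x.length (y.length - x.length) else 0

theorem radialFunction_of_notMem {x y : Vertex d} (h : y ∉ subtree x) :
    radialFunction d lam bet z x y = 0 :=
  if_neg h

theorem radialFunction_append (x w : Vertex d) :
    radialFunction d lam bet z x (w ++ x) =
      (((√(d : ℝ) : ℝ) : ℂ) ^ w.length)⁻¹ * radialCoeff d lam bet z x.length w.length := by
  rw [radialFunction, if_pos ⟨w, rfl⟩]
  simp

theorem radialFunction_congr {x y y' : Vertex d} (hy : y ∈ subtree x) (hy' : y' ∈ subtree x)
    (h : y.length = y'.length) :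
    radialFunction d lam bet z x y = radialFunction d lam bet z x y' := by
  rw [radialFunction, radialFunction, if_pos (show x <:+ y from hy),
    if_pos (show x <:+ y' from hy'), h]

theorem radialFunction_self [NeZero d] (hlam : ∀ n, 0 < lam n) (x : Vertex d) :
    radialFunction d lam bet z x x = 1 := by
  simpa [radialCoeff_zero hlam] using radialFunction_append (lam := lam) (bet := bet) (z := z) x []

theorem sqrt_natCast_ne_zero [NeZero d] : ((√(d : ℝ) : ℝ) : ℂ) ≠ 0 := by
  exact_mod_cast (Real.sqrt_pos.2 (by exact_mod_cast NeZero.pos d : (0 : ℝ) < d)).ne'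

theorem sqrt_natCast_mul_self : ((√(d : ℝ) : ℝ) : ℂ) * ((√(d : ℝ) : ℝ) : ℂ) = d := by
  rw [← Complex.ofReal_mul, Real.mul_self_sqrt (by positivity)]
  simp

theorem cons_mem_subtree_iff {x y : Vertex d} {i : Fin d} :
    i :: y ∈ subtree x ↔ x = i :: y ∨ y ∈ subtree x :=
  List.suffix_cons_iff

/-- For `w = []` the zero of the fundamental solution at `|x|` matches the vanishing of `f_x` at the
predecessor of `x`, so the equation at `x` needs no separate treatment. -/
theorem parentValue_radialFunction_append [NeZero d] (x w : Vertex d) :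
    parentValue (radialFunction d lam bet z x) (w ++ x) =
      ((√(d : ℝ) : ℝ) : ℂ) * (((√(d : ℝ) : ℝ) : ℂ) ^ w.length)⁻¹
        * fundamentalSolution d lam bet z x.length (x.length + w.length) := by
  rcases w with _ | ⟨j, w⟩
  · rcases x with _ | ⟨i, x⟩
    · simp [parentValue, fundamentalSolution_self]
    · have : x ∉ subtree (i :: x) := fun h => by simpa using List.IsSuffix.length_le h
      simp only [List.nil_append, List.length_nil, add_zero, fundamentalSolution_self, mul_zero]
      exact radialFunction_of_notMem this
  · have hr0 := sqrt_natCast_ne_zero (d := d)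
    refine (radialFunction_append x w).trans ?_
    rw [List.length_cons, pow_succ, mul_inv_rev, mul_inv_cancel_left₀ hr0, radialCoeff]

theorem jacobiAction_radialFunction_of_mem [NeZero d] (hlam : ∀ n, 0 < lam n) {x y : Vertex d}
    (hy : y ∈ subtree x) : jacobiAction lam bet (radialFunction d lam bet z x) y =
      z * radialFunction d lam bet z x y := by
  obtain ⟨w, rfl⟩ := hy
  have hr0 := sqrt_natCast_ne_zero (d := d)
  have hsum : ∑ i : Fin d, radialFunction d lam bet z x (i :: (w ++ x)) =
      d * ((((√(d : ℝ) : ℝ) : ℂ) ^ (w.length + 1))⁻¹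
        * fundamentalSolution d lam bet z x.length (x.length + (w.length + 2))) := by
    have h : ∀ i, radialFunction d lam bet z x (i :: (w ++ x)) = _ := fun i =>
      radialFunction_append x (i :: w)
    simp [h, radialCoeff]
  have hrec := isThreeTermSolution_fundamentalSolution (bet := bet) (z := z) (d := d) hlam x.length
    (x.length + w.length)
  rw [jacobiAction_eq, hsum, parentValue_radialFunction_append, radialFunction_append, radialCoeff,
    List.length_append, add_comm w.length, ← sqrt_natCast_mul_self]
  set r : ℂ := ((√(d : ℝ) : ℝ) : ℂ) with hr
  have hrn : r ^ w.length ≠ 0 := pow_ne_zero _ hr0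
  simp only [extLam, extBet, Complex.ofReal_mul, ← hr] at hrec ⊢
  rw [pow_succ]
  rw [← add_assoc, ← add_assoc]
  field_simp
  linear_combination -hrec

/-- The only vertex outside `Γ_{x_i}` with a neighbour in it is `x`, where the value `1` at `x_i`
leaves an error `λ_{|x|}`. This error does not depend on `i`, so it cancels in zero-sum combinations
of siblings. -/
theorem jacobiAction_radialFunction_cons [NeZero d] (hlam : ∀ n, 0 < lam n) (x y : Vertex d)
    (i : Fin d) : jacobiAction lam bet (radialFunction d lam bet z (i :: x)) y =
      z * radialFunction d lam bet z (i :: x) y + if y = x then (lam x.length : ℂ) else 0 := by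
  by_cases hy : y ∈ subtree (i :: x)
  · rw [jacobiAction_radialFunction_of_mem hlam hy, if_neg, add_zero]
    rintro rfl
    simpa using List.IsSuffix.length_le hy
  · have hpar : parentValue (radialFunction d lam bet z (i :: x)) y = 0 := by
      rcases y with _ | ⟨j, y⟩
      · rfl
      · exact radialFunction_of_notMem fun h => hy (cons_mem_subtree_iff.2 (Or.inr h))
    rw [jacobiAction_eq, hpar, radialFunction_of_notMem hy, mul_zero, mul_zero, mul_zero, zero_add,
      zero_add, zero_add]
    split_ifs with h
    · subst h
      rw [Fintype.sum_eq_single i, radialFunction_self hlam, mul_one]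
      intro j hj
      refine radialFunction_of_notMem fun h => ?_
      rcases cons_mem_subtree_iff.1 h with h | h
      · exact hj (List.cons_eq_cons.1 h).1.symm
      · exact hy h
    · rw [Finset.sum_eq_zero, mul_zero]
      intro j _
      refine radialFunction_of_notMem fun h' => ?_
      rcases cons_mem_subtree_iff.1 h' with h' | h'
      · exact h (List.cons_eq_cons.1 h').2.symm
      · exact hy h'

theorem levelSum_norm_radialFunction [NeZero d] (n : ℕ) (x : Vertex d) :
    levelSum n (fun y => ‖radialFunction d lam bet z x y‖ ^ 2) x
      = alphaTerm d lam bet z x.length n := by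
  have hd : ((d : ℝ) ^ n) ≠ 0 := pow_ne_zero _ (by exact_mod_cast NeZero.ne d)
  rw [levelSum_of_forall_eq (a := ((d : ℝ) ^ n)⁻¹ * alphaTerm d lam bet z x.length n),
    mul_inv_cancel_left₀ hd]
  rintro w rfl
  rw [radialFunction_append, norm_mul, mul_pow, norm_radialCoeff_sq, norm_inv, norm_pow,
    Complex.norm_real, Real.norm_of_nonneg (Real.sqrt_nonneg _), inv_pow, ← pow_mul,
    mul_comm w.length, pow_mul, Real.sq_sqrt (by positivity)]

theorem memℓp_radialFunction [NeZero d] {x : Vertex d}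
    (hs : Summable (alphaTerm d lam bet z x.length)) :
    Memℓp (radialFunction d lam bet z x) 2 := by
  refine memℓp_gen ?_
  have := summable_of_summable_levelSum (g := fun y => ‖radialFunction d lam bet z x y‖ ^ 2)
    (x := x) (fun _ => by positivity) (fun y hy => by simp [radialFunction_of_notMem hy])
    (hs.congr fun n => (levelSum_norm_radialFunction n x).symm)
  simpa using this

/-- The function `f_x` as an element of `ℓ²(Γ_d)`. -/
def radialVector [NeZero d] (hs : ∀ k, Summable (alphaTerm d lam bet z k)) (x : Vertex d) :
    L2Tree d :=
  ⟨radialFunction d lam bet z x, memℓp_radialFunction (hs x.length)⟩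

theorem alphaTerm_nonneg (k n : ℕ) : 0 ≤ alphaTerm d lam bet z k n := by
  rw [← norm_radialCoeff_sq]
  positivity

theorem alpha_sq (k : ℕ) : alpha d lam bet z k ^ 2 = ∑' n, alphaTerm d lam bet z k n :=
  Real.sq_sqrt (tsum_nonneg fun n => alphaTerm_nonneg k n)

theorem alpha_pos [NeZero d] (hlam : ∀ n, 0 < lam n) {k : ℕ}
    (hs : Summable (alphaTerm d lam bet z k)) : 0 < alpha d lam bet z k := by
  refine Real.sqrt_pos.2 (hs.tsum_pos (fun n => alphaTerm_nonneg k n) 0 ?_)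
  rw [← norm_radialCoeff_sq, radialCoeff_zero hlam]
  simp

/-- The equation at a vertex of `Γ_x` determines the sum over its successors, and by radiality this
sum is `d` times their common value. The function is thus fixed level by level from its value at
`x`. -/
theorem IsRadialDeficiencyFunction.unique [NeZero d] (hlam : ∀ n, 0 < lam n) {x : Vertex d} {f g : L2Tree d}
    (hf : IsRadialDeficiencyFunction lam bet z x f)
    (hg : IsRadialDeficiencyFunction lam bet z x g) : f = g := by
  ext y
  induction hn : y.length using Nat.strong_induction_on generalizing y with
  | _ n ih =>
    subst hn
    by_cases hy : y ∈ subtree x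
    · by_cases hyx : y = x
      · rw [hyx, hf.apply_self, hg.apply_self]
      · rcases y with _ | ⟨i, y⟩
        · exact absurd (List.suffix_nil.1 hy).symm hyx
        have hy' : y ∈ subtree x :=
          (cons_mem_subtree_iff.1 hy).resolve_left fun h => hyx h.symm
        have hsucc : ∀ h : L2Tree d, IsRadialDeficiencyFunction lam bet z x h →
            ∑ j : Fin d, h (j :: y) = d * h (i :: y) := fun h hh => by
          rw [Finset.sum_congr rfl fun j _ => hh.radial (j :: y)
            (cons_mem_subtree_iff.2 (Or.inr hy')) (i :: y) hy rfl]
          simp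
        have hpar : parentValue f y = parentValue g y := by
          rcases y with _ | ⟨j, y⟩
          · rfl
          · exact ih y.length (by simp) y rfl
        have e1 := hf.eigen y hy'
        have e2 := hg.eigen y hy'
        rw [jacobiAction_eq, hsucc _ hf, hpar, ih y.length (by simp) y rfl] at e1
        rw [jacobiAction_eq, hsucc _ hg] at e2
        have h1 : (lam y.length : ℂ) ≠ 0 := by exact_mod_cast (hlam _).ne'
        have h2 : (d : ℂ) ≠ 0 := by exact_mod_cast NeZero.ne d
        refine mul_left_cancel₀ h2 (mul_left_cancel₀ h1 ?_)
        linear_combination e1 - e2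
    · rw [hf.eq_zero y hy, hg.eq_zero y hy]

variable [NeZero d] (hs : ∀ k, Summable (alphaTerm d lam bet z k))

theorem radialVector_of_notMem {x y : Vertex d} (h : y ∉ subtree x) : radialVector hs x y = 0 :=
  radialFunction_of_notMem h

theorem radialVector_append (x w : Vertex d) :
    radialVector hs x (w ++ x) =
      (((√(d : ℝ) : ℝ) : ℂ) ^ w.length)⁻¹ * radialCoeff d lam bet z x.length w.length :=
  radialFunction_append x w

theorem norm_radialVector (x : Vertex d) :
    ‖radialVector hs x‖ = alpha d lam bet z x.length := by
  have h1 := (summable_norm_sq (radialVector hs x)).hasSum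
  have h2 := (hasSum_levelSum (x := x) h1 fun y hy => by
    simp [radialVector_of_notMem hs hy]).tsum_eq
  have h3 := lp.norm_rpow_eq_tsum (p := 2) (by simp) (radialVector hs x)
  rw [alpha, ← Real.sqrt_sq (norm_nonneg (radialVector hs x))]
  congr 1
  simp only [ENNReal.toReal_ofNat, Real.rpow_ofNat] at h3
  rw [h3, ← h2]
  exact tsum_congr fun n => levelSum_norm_radialFunction n x

theorem isRadialDeficiencyFunction_radialVector (hlam : ∀ n, 0 < lam n) (x : Vertex d) :
    IsRadialDeficiencyFunction lam bet z x (radialVector hs x) where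
  eq_zero _ hy := radialFunction_of_notMem hy
  radial _ hy _ hy' h := radialFunction_congr hy hy' h
  apply_self := radialFunction_self hlam x
  eigen _ hy := jacobiAction_radialFunction_of_mem hlam hy

/-- Since `f_x` is constant on a level, its product with `v` there is that constant, conjugated,
times the level sum of `v`, which `levelSum_eq` supplies. -/
theorem levelSum_inner_radialVector (hlam : ∀ n, 0 < lam n) {v : L2Tree d} {x : Vertex d}
    (hv : ∀ y, jacobiAction lam bet v y = z * v y) (hx : parentValue v x = 0) (n : ℕ) :
    levelSum n (fun y => inner ℂ (radialVector hs x y) (v y)) x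
      = v x * (alphaTerm d lam bet z x.length n : ℝ) := by
  have h3 : levelSum n (fun y => inner ℂ (radialVector hs x y) (v y)) x
      = (((√(d : ℝ) : ℝ) : ℂ) ^ n)⁻¹ * conj (radialCoeff d lam bet z x.length n)
        * levelSum n v x := by
    rw [levelSum, levelSum, Finset.mul_sum]
    refine Finset.sum_congr rfl fun w _ => ?_
    rw [RCLike.inner_apply, radialVector_append, w.2]
    simp only [map_mul, map_inv₀, map_pow, Complex.conj_ofReal]
    ring
  rw [h3, levelSum_eq hlam (fun y _ => hv y) hx, ← norm_radialCoeff_sq, ← Complex.normSq_eq_norm_sq,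
    ← Complex.mul_conj]
  have hrn := pow_ne_zero n (sqrt_natCast_ne_zero (d := d))
  field_simp

/-- The inner product of `f_x` with a solution on `Γ_x`. -/
theorem inner_radialVector (hlam : ∀ n, 0 < lam n) {v : L2Tree d} {x : Vertex d}
    (hv : v ∈ deficiencySpace (jacobiOperator d lam bet) z) (hx : parentValue v x = 0) :
    inner ℂ (radialVector hs x) v = v x * (alpha d lam bet z x.length ^ 2 : ℝ) := by
  rw [mem_deficiencySpace_jacobi_iff] at hv
  have h0 : ∀ y ∉ subtree x, inner ℂ (radialVector hs x y) (v y) = 0 := fun y hy => by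
    rw [radialVector_of_notMem hs hy, inner_zero_left]
  have h1 : HasSum (fun n => levelSum n (fun y => inner ℂ (radialVector hs x y) (v y)) x)
      (inner ℂ (radialVector hs x) v) :=
    hasSum_levelSum (lp.hasSum_inner (radialVector hs x) v) h0
  have h2 : HasSum (fun n => v x * (alphaTerm d lam bet z x.length n : ℂ))
      (v x * (alpha d lam bet z x.length ^ 2 : ℝ)) := by
    rw [alpha_sq]
    exact (Complex.hasSum_ofReal.2 (hs _).hasSum).mul_left _
  have h3 := funext fun n => levelSum_inner_radialVector hs hlam hv hx n
  rw [h3] at h1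
  exact h1.unique h2

end RadialFunction

/-! ### Orthonormal systems of wavelet type on a tree -/

section TreeSystem

variable {d : ℕ} {H : Type*} [NormedAddCommGroup H] [InnerProductSpace ℂ H]

/-- A family of unit vectors indexed by the vertices, orthogonal for incomparable vertices, such
that the inner product of `φ_y` with `φ_{x_i}` does not depend on `i` for `x ∈ Γ_y`. -/
structure IsTreeSystem (φ : Vertex d → H) : Prop where
  norm_eq_one : ∀ x, ‖φ x‖ = 1
  inner_eq_zero : ∀ x y, ¬ x <:+ y → ¬ y <:+ x → inner ℂ (φ x) (φ y) = 0
  inner_cons : ∀ x y i j, y <:+ x → inner ℂ (φ y) (φ (i :: x)) = inner ℂ (φ y) (φ (j :: x))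

/-- The vectors of coefficients with sum zero. -/
def zeroSum (d : ℕ) : Submodule ℂ (EuclideanSpace ℂ (Fin d)) where
  carrier := {a | ∑ i, a i = 0}
  add_mem' {a b} ha hb := by
    simp only [Set.mem_ofPred_eq] at ha hb ⊢
    simp [Finset.sum_add_distrib, ha, hb]
  zero_mem' := by simp
  smul_mem' c a ha := by
    simp only [Set.mem_ofPred_eq] at ha ⊢
    simp [← Finset.mul_sum, ha]

/-- An index set for orthonormal bases of wavelet type. -/
abbrev WaveletIndex (d : ℕ) : Type :=
  Option (Vertex d × Fin (Module.finrank ℂ (zeroSum d)))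

/-- The vectors `φ_e` and `∑ a_i φ_{x_i}`, where `a` runs through an orthonormal basis of the
vectors with sum zero. -/
def wavelet (φ : Vertex d → H) : WaveletIndex d → H
  | none => φ []
  | some (x, j) => ∑ i, (stdOrthonormalBasis ℂ (zeroSum d) j : EuclideanSpace ℂ (Fin d)) i • φ (i :: x)

theorem sum_smul_eq_sum_wavelet (φ : Vertex d → H) (x : Vertex d) {a : Fin d → ℂ}
    (ha : WithLp.toLp 2 a ∈ zeroSum d) : ∑ i, a i • φ (i :: x) =
      ∑ j, (stdOrthonormalBasis ℂ (zeroSum d)).repr ⟨_, ha⟩ j • wavelet φ (some (x, j)) := by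
  have h := congrArg Subtype.val ((stdOrthonormalBasis ℂ (zeroSum d)).sum_repr ⟨_, ha⟩)
  have h1 : ∀ i, a i = ∑ j, (stdOrthonormalBasis ℂ (zeroSum d)).repr ⟨_, ha⟩ j *
      (stdOrthonormalBasis ℂ (zeroSum d) j : EuclideanSpace ℂ (Fin d)) i := fun i => by
    have h2 := congrArg (fun b : EuclideanSpace ℂ (Fin d) => b i) h
    simpa using h2.symm
  simp only [wavelet, Finset.smul_sum, smul_smul]
  rw [Finset.sum_comm]
  refine Finset.sum_congr rfl fun i _ => ?_
  rw [← Finset.sum_smul, ← h1]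

namespace IsTreeSystem

variable {φ : Vertex d → H}

/-- Either `y` is `x` or an ancestor of it, and `φ y` has equal products with all successors of `x`,
which zero-sum coefficients annihilate; or `y` is incomparable with every successor of `x`. -/
theorem inner_sum_eq_zero (hφ : IsTreeSystem φ) {x y : Vertex d} (hy : ∀ i, ¬ i :: x <:+ y)
    {a : Fin d → ℂ} (ha : ∑ i, a i = 0) : inner ℂ (φ y) (∑ i, a i • φ (i :: x)) = 0 := by
  rw [inner_sum]
  by_cases hyx : y <:+ x
  · rcases isEmpty_or_nonempty (Fin d) with h | ⟨⟨j⟩⟩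
    · simp
    · simp_rw [inner_smul_right, hφ.inner_cons x y _ j hyx]
      rw [← Finset.sum_mul, ha, zero_mul]
  · refine Finset.sum_eq_zero fun i _ => ?_
    rw [inner_smul_right, hφ.inner_eq_zero, mul_zero]
    · intro h
      rcases List.suffix_cons_iff.1 h with rfl | h
      · exact hy i (List.suffix_refl _)
      · exact hyx h
    · exact hy i

theorem orthonormal_children (hφ : IsTreeSystem φ) (x : Vertex d) :
    Orthonormal ℂ fun i => φ (i :: x) := by
  refine ⟨fun i => hφ.norm_eq_one _, fun i j hij => hφ.inner_eq_zero _ _ ?_ ?_⟩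
  · intro h
    exact hij (List.cons_eq_cons.1 (h.eq_of_length (by simp))).1
  · intro h
    exact hij (List.cons_eq_cons.1 (h.eq_of_length (by simp))).1.symm

theorem inner_sum_sum_eq_zero (hφ : IsTreeSystem φ) {x y : Vertex d} (hxy : x ≠ y)
    {a b : Fin d → ℂ} (ha : ∑ i, a i = 0) (hb : ∑ i, b i = 0) :
    inner ℂ (∑ i, a i • φ (i :: x)) (∑ i, b i • φ (i :: y)) = 0 := by
  have key : ∀ {x y : Vertex d} {a b : Fin d → ℂ}, (∑ i, b i = 0) →
      (∀ i j : Fin d, ¬ j :: y <:+ i :: x) →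
      inner ℂ (∑ i, a i • φ (i :: x)) (∑ i, b i • φ (i :: y)) = 0 := by
    intro x y a b hb h
    rw [sum_inner]
    refine Finset.sum_eq_zero fun i _ => ?_
    rw [inner_smul_left, hφ.inner_sum_eq_zero (h i) hb, mul_zero]
  by_cases h : ∀ i j : Fin d, ¬ j :: y <:+ i :: x
  · exact key hb h
  -- Exchange the two sums. If a successor of `x` were also above a successor of `y`, then `x` and
  -- `y` would have equal length and the suffix relation would give `x = y`.
  · rw [← inner_conj_symm, key ha, map_zero]
    push Not at h
    obtain ⟨i, j, h⟩ := h
    intro i' j' h'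
    have h1 := h.length_le
    have h2 := h'.length_le
    simp only [List.length_cons] at h1 h2
    exact hxy (List.cons_eq_cons.1 (h.eq_of_length (by simp; omega))).2.symm

theorem orthonormal_wavelet (hφ : IsTreeSystem φ) : Orthonormal ℂ (wavelet φ) := by
  have hroot : ∀ x j, inner ℂ (wavelet φ none) (wavelet φ (some (x, j))) = 0 := fun x j =>
    hφ.inner_sum_eq_zero (y := []) (fun i h => by simp at h)
      (stdOrthonormalBasis ℂ (zeroSum d) j).2
  have hself : ∀ x j j', inner ℂ (wavelet φ (some (x, j))) (wavelet φ (some (x, j')))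
      = if j = j' then 1 else 0 := fun x j j' => by
    rw [wavelet, wavelet, (hφ.orthonormal_children x).inner_sum,
      ← orthonormal_iff_ite.1 (stdOrthonormalBasis ℂ (zeroSum d)).orthonormal j j',
      Submodule.coe_inner, PiLp.inner_apply]
    simp [mul_comm]
  rw [orthonormal_iff_ite]
  rintro (_ | ⟨x, j⟩) (_ | ⟨x', j'⟩)
  · rw [if_pos rfl, wavelet, inner_self_eq_norm_sq_to_K, hφ.norm_eq_one]
    simp
  · rw [if_neg (by simp), hroot]
  · rw [if_neg (by simp), ← inner_conj_symm, hroot, map_zero]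
  · by_cases hx : x = x'
    · subst hx
      simp [hself]
    · rw [if_neg (by simp [hx]), wavelet, wavelet, hφ.inner_sum_sum_eq_zero hx]
      · exact (stdOrthonormalBasis ℂ (zeroSum d) j).2
      · exact (stdOrthonormalBasis ℂ (zeroSum d) j').2

end IsTreeSystem

/-- A vector orthogonal to the wavelets has equal inner products with `φ_{x_1}, …, φ_{x_d}`. -/
theorem inner_cons_eq_of_forall_wavelet {φ : Vertex d → H} {v : H}
    (hv : ∀ k, inner ℂ (wavelet φ k) v = 0) (x : Vertex d) (i j : Fin d) :
    inner ℂ (φ (i :: x)) v = inner ℂ (φ (j :: x)) v := by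
  let a : Fin d → ℂ := Pi.single i 1 - Pi.single j 1
  have ha : WithLp.toLp 2 a ∈ zeroSum d := by
    show ∑ k, a k = 0
    simp [a]
  have h : ∑ k, a k • φ (k :: x) = φ (i :: x) - φ (j :: x) := by
    simp [a, sub_smul, Finset.sum_sub_distrib, Pi.single_apply, ite_smul]
  rw [← sub_eq_zero, ← inner_sub_left, ← h, sum_smul_eq_sum_wavelet φ x ha, sum_inner]
  exact Finset.sum_eq_zero fun k _ => by rw [inner_smul_left, hv, mul_zero]

end TreeSystem

/-! ### The tree system of the deficiency space -/

section Deficiency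

variable {d : ℕ} {lam bet : ℕ → ℝ} {z : ℂ}

theorem jacobiAction_smul (c : ℂ) (v : L2Tree d) (y : Vertex d) :
    jacobiAction lam bet (c • v : L2Tree d) y = c * jacobiAction lam bet v y := by
  rcases y with _ | ⟨j, y⟩ <;> simp [jacobiAction, ← Finset.mul_sum] <;> ring

theorem jacobiAction_sum {ι : Type*} (s : Finset ι) (v : ι → L2Tree d) (y : Vertex d) :
    jacobiAction lam bet (∑ i ∈ s, v i : L2Tree d) y = ∑ i ∈ s, jacobiAction lam bet (v i) y := by
  have hc : ∀ y, (∑ i ∈ s, v i : L2Tree d) y = ∑ i ∈ s, v i y := fun y => by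
    rw [lp.coeFn_sum, Finset.sum_apply]
  rcases y with _ | ⟨j, y⟩ <;>
  simp only [jacobiAction, hc, Finset.mul_sum, Finset.sum_add_distrib] <;>
  rw [Finset.sum_comm (s := Finset.univ)]

variable [NeZero d] (hs : ∀ k, Summable (alphaTerm d lam bet z k))

/-- The functions `f_x / ‖f_x‖`. -/
def unitRadialVector (x : Vertex d) : L2Tree d :=
  ((alpha d lam bet z x.length : ℂ))⁻¹ • radialVector hs x

theorem inner_radialVector_of_not_suffix {x y : Vertex d} (h1 : ¬ x <:+ y) (h2 : ¬ y <:+ x) :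
    inner ℂ (radialVector hs x) (radialVector hs y) = 0 := by
  refine (lp.inner_eq_tsum _ _).trans ((tsum_congr fun w => ?_).trans tsum_zero)
  by_cases hx : w ∈ subtree x
  · have hy : w ∉ subtree y := fun hy => (List.suffix_or_suffix_of_suffix hx hy).elim h1 h2
    rw [radialVector_of_notMem hs hy, inner_zero_right]
  · rw [radialVector_of_notMem hs hx, inner_zero_left]

theorem inner_radialVector_cons (x y : Vertex d) (i : Fin d) :
    inner ℂ (radialVector hs y) (radialVector hs (i :: x)) =
      ∑' w : Vertex d, inner ℂ (radialVector hs y (w ++ i :: x))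
        (radialVector hs (i :: x) (w ++ i :: x)) := by
  have h0 : ∀ w ∉ subtree (i :: x),
      inner ℂ (radialVector hs y w) (radialVector hs (i :: x) w) = 0 := fun w hw => by
    rw [radialVector_of_notMem hs hw, inner_zero_right]
  exact ((hasSum_append_of_eq_zero h0).2
    (lp.hasSum_inner (radialVector hs y) (radialVector hs (i :: x)))).tsum_eq.symm

/-- The condition on siblings holds because the map `w ++ i :: x ↦ w ++ j :: x` carries `f_{x_i}` to
`f_{x_j}`, while `f_y` is radial and takes equal values at the two vertices. -/
theorem isTreeSystem_unitRadialVector (hlam : ∀ n, 0 < lam n) :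
    IsTreeSystem (unitRadialVector hs) where
  norm_eq_one x := by
    have h := alpha_pos hlam (hs x.length)
    rw [unitRadialVector, norm_smul, norm_radialVector, norm_inv, Complex.norm_real,
      Real.norm_of_nonneg h.le, inv_mul_cancel₀ h.ne']
  inner_eq_zero x y h1 h2 := by
    rw [unitRadialVector, unitRadialVector, inner_smul_left, inner_smul_right,
      inner_radialVector_of_not_suffix hs h1 h2, mul_zero, mul_zero]
  inner_cons x y i j h := by
    rw [unitRadialVector, unitRadialVector, unitRadialVector, inner_smul_left, inner_smul_right,
      inner_smul_left, inner_smul_right, inner_radialVector_cons, inner_radialVector_cons]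
    congr 2
    refine tsum_congr fun w => ?_
    rw [radialVector_append hs (i :: x), radialVector_append hs (j :: x)]
    have hy : ∀ k : Fin d, w ++ k :: x ∈ subtree y := fun k =>
      h.trans ((List.suffix_cons k x).trans (List.suffix_append w _))
    have : radialVector hs y (w ++ i :: x) = radialVector hs y (w ++ j :: x) :=
      radialFunction_congr (hy i) (hy j) (by simp)
    rw [this]
    rfl

theorem radialVector_root_mem (hlam : ∀ n, 0 < lam n) :
    radialVector hs [] ∈ deficiencySpace (jacobiOperator d lam bet) z :=
  mem_deficiencySpace_jacobi_iff.2 fun _ =>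
    jacobiAction_radialFunction_of_mem hlam List.nil_suffix

theorem sum_smul_radialVector_mem (hlam : ∀ n, 0 < lam n) (x : Vertex d) {a : Fin d → ℂ}
    (ha : ∑ i, a i = 0) : ∑ i, a i • radialVector hs (i :: x) ∈
      deficiencySpace (jacobiOperator d lam bet) z := by
  refine mem_deficiencySpace_jacobi_iff.2 fun y => ?_
  have h1 : ∀ i, jacobiAction lam bet (radialVector hs (i :: x)) y =
      z * radialVector hs (i :: x) y + if y = x then (lam x.length : ℂ) else 0 := fun i =>
    jacobiAction_radialFunction_cons hlam x y i
  rw [jacobiAction_sum, lp.coeFn_sum, Finset.sum_apply,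
    Finset.sum_congr rfl fun i _ => jacobiAction_smul (a i) (radialVector hs (i :: x)) y]
  simp only [h1, mul_add, Finset.sum_add_distrib, ← Finset.sum_mul, ha, zero_mul,
    add_zero, lp.coeFn_smul, Pi.smul_apply, smul_eq_mul, Finset.mul_sum]
  exact Finset.sum_congr rfl fun i _ => by ring

theorem sum_smul_unitRadialVector (x : Vertex d) (a : Fin d → ℂ) :
    ∑ i, a i • unitRadialVector hs (i :: x) =
      ((alpha d lam bet z (x.length + 1) : ℂ))⁻¹ • ∑ i, a i • radialVector hs (i :: x) := by
  rw [Finset.smul_sum]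
  exact Finset.sum_congr rfl fun i _ => smul_comm _ _ _

theorem wavelet_mem_deficiencySpace (hlam : ∀ n, 0 < lam n) (k : WaveletIndex d) :
    wavelet (unitRadialVector hs) k ∈ deficiencySpace (jacobiOperator d lam bet) z := by
  rcases k with _ | ⟨x, j⟩
  · exact Submodule.smul_mem _ _ (radialVector_root_mem hs hlam)
  · rw [wavelet, sum_smul_unitRadialVector]
    exact Submodule.smul_mem _ _
      (sum_smul_radialVector_mem hs hlam x (stdOrthonormalBasis ℂ (zeroSum d) j).2)

/-- Induction down the tree: once `v` vanishes at `x` and at its predecessor, the products with the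
`f_{x_i}` recover the values `v(x_i)`, which are then equal, and the equation at `x` says that their
sum is zero. -/
theorem eq_zero_of_inner_unitRadialVector (hlam : ∀ n, 0 < lam n) {v : L2Tree d}
    (hv : v ∈ deficiencySpace (jacobiOperator d lam bet) z)
    (h0 : inner ℂ (unitRadialVector hs []) v = 0)
    (hcons : ∀ x i j, inner ℂ (unitRadialVector hs (i :: x)) v
      = inner ℂ (unitRadialVector hs (j :: x)) v) : v = 0 := by
  have hval : ∀ x, parentValue v x = 0 → inner ℂ (unitRadialVector hs x) v
      = (alpha d lam bet z x.length : ℂ) * v x := fun x hx => by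
    have h : (alpha d lam bet z x.length : ℂ) ≠ 0 := by
      exact_mod_cast (alpha_pos hlam (hs x.length)).ne'
    rw [unitRadialVector, inner_smul_left, inner_radialVector hs hlam hv hx, map_inv₀,
      Complex.conj_ofReal]
    push_cast
    field_simp
  have hα : ∀ k, (alpha d lam bet z k : ℂ) ≠ 0 := fun k => by
    exact_mod_cast (alpha_pos hlam (hs k)).ne'
  have hzero : ∀ x, v x = 0 ∧ parentValue v x = 0 := by
    intro x
    induction x with
    | nil =>
      rw [hval [] rfl] at h0
      exact ⟨(mul_eq_zero.1 h0).resolve_left (hα _), rfl⟩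
    | cons i x ih =>
      refine ⟨?_, ih.1⟩
      have heq : ∀ j, v (j :: x) = v (i :: x) := fun j => by
        have := hcons x j i
        rw [hval (j :: x) ih.1, hval (i :: x) ih.1] at this
        exact mul_left_cancel₀ (hα _) this
      have h1 := mem_deficiencySpace_jacobi_iff.1 hv x
      rw [jacobiAction_eq, ih.1, ih.2, Finset.sum_congr rfl fun j _ => heq j] at h1
      have h2 : (lam x.length : ℂ) ≠ 0 := by exact_mod_cast (hlam _).ne'
      have h3 : (d : ℂ) ≠ 0 := by exact_mod_cast NeZero.ne d
      simpa [h2, h3] using h1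
  exact lp.ext (funext fun x => (hzero x).1)

/-- A Hilbert basis of the deficiency space. -/
theorem exists_hilbertBasis_deficiencySpace (hlam : ∀ n, 0 < lam n) :
    ∃ b : HilbertBasis (WaveletIndex d) ℂ (deficiencySpace (jacobiOperator d lam bet) z),
      ∀ k, (b k : L2Tree d) = wavelet (unitRadialVector hs) k := by
  have hmem := wavelet_mem_deficiencySpace hs hlam
  let w : WaveletIndex d → deficiencySpace (jacobiOperator d lam bet) z := fun k => ⟨_, hmem k⟩
  have ho : Orthonormal ℂ w := by
    have := (isTreeSystem_unitRadialVector hs hlam).orthonormal_wavelet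
    rw [orthonormal_iff_ite] at this ⊢
    exact this
  have : CompleteSpace (deficiencySpace (jacobiOperator d lam bet) z) :=
    (Submodule.isClosed_orthogonal _).completeSpace_coe
  refine ⟨HilbertBasis.mkOfOrthogonalEqBot ho ?_, fun k => ?_⟩
  · rw [Submodule.eq_bot_iff]
    intro v hv
    have hk : ∀ k, inner ℂ (wavelet (unitRadialVector hs) k) (v : L2Tree d) = 0 := fun k =>
      (Submodule.mem_orthogonal _ _).1 hv (w k) (Submodule.subset_span ⟨k, rfl⟩)
    exact Subtype.ext (eq_zero_of_inner_unitRadialVector hs hlam v.2 (hk none)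
      (inner_cons_eq_of_forall_wavelet hk))
  · rw [HilbertBasis.coe_mkOfOrthogonalEqBot]

end Deficiency

/-! ### Cylinders -/

section Cylinder

variable {d : ℕ}

theorem length_vertexAt (ω : Boundary d) (n : ℕ) : (vertexAt ω n).length = n := by
  induction n with
  | zero => rfl
  | succ n ih => simp [vertexAt, ih]

theorem mem_cylinder_iff {x : Vertex d} {ω : Boundary d} :
    ω ∈ cylinder x ↔ vertexAt ω x.length = x := by
  refine ⟨?_, fun h => ⟨_, h⟩⟩
  rintro ⟨n, rfl⟩
  rw [length_vertexAt]

theorem mem_cylinder_cons_iff {x : Vertex d} {i : Fin d} {ω : Boundary d} :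
    ω ∈ cylinder (i :: x) ↔ ω ∈ cylinder x ∧ ω x.length = i := by
  rw [mem_cylinder_iff, mem_cylinder_iff, List.length_cons, vertexAt, List.cons_eq_cons, and_comm]

theorem cylinder_nil : cylinder ([] : Vertex d) = Set.univ :=
  Set.eq_univ_of_forall fun _ => ⟨0, rfl⟩

theorem cylinder_subset {x y : Vertex d} (h : y <:+ x) : cylinder x ⊆ cylinder y := by
  obtain ⟨w, rfl⟩ := h
  induction w with
  | nil => exact subset_rfl
  | cons i w ih => exact fun ω hω => ih (mem_cylinder_cons_iff.1 hω).1

theorem vertexAt_suffix (ω : Boundary d) {m n : ℕ} (h : m ≤ n) : vertexAt ω m <:+ vertexAt ω n := by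
  induction n, h using Nat.le_induction with
  | base => exact List.suffix_refl _
  | succ n _ ih => exact ih.trans (List.suffix_cons _ _)

theorem disjoint_cylinder {x y : Vertex d} (h : ¬ x <:+ y) (h' : ¬ y <:+ x) :
    Disjoint (cylinder x) (cylinder y) := by
  rw [Set.disjoint_left]
  rintro ω ⟨m, rfl⟩ ⟨n, rfl⟩
  rcases le_total m n with hmn | hmn
  · exact h (vertexAt_suffix ω hmn)
  · exact h' (vertexAt_suffix ω hmn)

theorem cylinder_eq_iUnion (x : Vertex d) : cylinder x = ⋃ i : Fin d, cylinder (i :: x) := by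
  ext ω
  simp [mem_cylinder_cons_iff]

theorem pairwise_disjoint_cylinder_cons (x : Vertex d) :
    Pairwise (Function.onFun Disjoint fun i : Fin d => cylinder (i :: x)) := by
  intro i j hij
  rw [Function.onFun, Set.disjoint_left]
  intro ω h h'
  exact hij ((mem_cylinder_cons_iff.1 h).2.symm.trans (mem_cylinder_cons_iff.1 h').2)

theorem exists_cylinder_eq_pi [NeZero d] (x : Vertex d) : ∃ c : ℕ → Fin d,
    cylinder x = Set.pi (Finset.range x.length) fun k => {c k} := by
  induction x with
  | nil => exact ⟨fun _ => 0, by simp [cylinder_nil]⟩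
  | cons i x ih =>
    obtain ⟨c, hc⟩ := ih
    refine ⟨Function.update c x.length i, ?_⟩
    ext ω
    rw [mem_cylinder_cons_iff, hc]
    simp only [Set.mem_pi, Finset.coe_range, Set.mem_Iio, Set.mem_singleton_iff, List.length_cons]
    constructor
    · rintro ⟨h, rfl⟩ k hk
      rcases (Nat.lt_succ_iff_lt_or_eq.1 hk) with hk | rfl
      · rw [Function.update_of_ne hk.ne, h k hk]
      · simp
    · intro h
      refine ⟨fun k hk => ?_, by simpa using h x.length (Nat.lt_succ_self _)⟩
      rw [h k (hk.trans (Nat.lt_succ_self _)), Function.update_of_ne hk.ne]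

theorem boundaryMeasure_cylinder [NeZero d] (x : Vertex d) :
    boundaryMeasure d (cylinder x) = ((d : ENNReal) ^ x.length)⁻¹ := by
  obtain ⟨c, hc⟩ := exists_cylinder_eq_pi x
  rw [hc, boundaryMeasure, Measure.infinitePi_pi _ fun _ _ => measurableSet_singleton _]
  simp [ProbabilityTheory.uniformOn_univ, ENNReal.inv_pow]

theorem boundaryMeasure_real_cylinder [NeZero d] (x : Vertex d) :
    (boundaryMeasure d).real (cylinder x) = ((d : ℝ) ^ x.length)⁻¹ := by
  rw [measureReal_def, boundaryMeasure_cylinder]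
  simp

theorem isPiSystem_cylinder : IsPiSystem (Set.range (cylinder : Vertex d → Set (Boundary d))) := by
  rintro _ ⟨x, rfl⟩ _ ⟨y, rfl⟩ ⟨ω, hx, hy⟩
  by_cases h : x <:+ y
  · exact ⟨y, (Set.inter_eq_right.2 (cylinder_subset h)).symm⟩
  · by_cases h' : y <:+ x
    · exact ⟨x, (Set.inter_eq_left.2 (cylinder_subset h')).symm⟩
    · exact absurd hy (Set.disjoint_left.1 (disjoint_cylinder h h') hx)

theorem generateFrom_cylinder :
    (MeasurableSpace.pi : MeasurableSpace (Boundary d)) =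
      MeasurableSpace.generateFrom (Set.range cylinder) := by
  refine le_antisymm (iSup_le fun n => ?_) (MeasurableSpace.generateFrom_le ?_)
  · rw [← measurable_iff_comap_le]
    refine @measurable_to_countable' _ _ _ _ (_) _ fun i => ?_
    have h : (fun ω : Boundary d => ω n) ⁻¹' {i} =
        ⋃ x ∈ {x : Vertex d | x.length = n}, cylinder (i :: x) := by
      ext ω
      simp only [Set.mem_preimage, Set.mem_singleton_iff, Set.mem_iUnion, mem_cylinder_cons_iff]
      constructor
      · exact fun h => ⟨vertexAt ω n, length_vertexAt ω n, ⟨n, rfl⟩, by rwa [length_vertexAt]⟩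
      · rintro ⟨x, rfl, -, h⟩
        exact h
    rw [h]
    exact MeasurableSet.biUnion (Set.to_countable _) fun x _ =>
      MeasurableSpace.measurableSet_generateFrom ⟨_, rfl⟩
  · rintro _ ⟨x, rfl⟩
    exact measurableSet_cylinder x

theorem sqrt_pow_mul_self (n : ℕ) :
    ((√((d : ℝ) ^ n) : ℝ) : ℂ) * ((√((d : ℝ) ^ n) : ℝ) : ℂ) = (d : ℂ) ^ n := by
  rw [← Complex.ofReal_mul, Real.mul_self_sqrt (by positivity)]
  simp

/-! ### The tree system of `L²(Ω)` -/

variable [NeZero d]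

theorem integrable_of_L2Boundary (F : L2Boundary d) : Integrable F (boundaryMeasure d) :=
  (Lp.memLp F).integrable one_le_two

theorem setIntegral_cylinder (F : L2Boundary d) (x : Vertex d) :
    ∫ ω in cylinder x, F ω ∂boundaryMeasure d =
      ∑ i, ∫ ω in cylinder (i :: x), F ω ∂boundaryMeasure d := by
  rw [cylinder_eq_iUnion]
  exact integral_iUnion_fintype (fun i => measurableSet_cylinder _)
    (pairwise_disjoint_cylinder_cons x) fun i => (integrable_of_L2Boundary F).integrableOn

/-- The cylinders form a π-system generating the product σ-algebra, so vanishing integrals over them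
propagate to all measurable sets. -/
theorem eq_zero_of_setIntegral_cylinder {F : L2Boundary d}
    (h : ∀ x : Vertex d, ∫ ω in cylinder x, F ω ∂boundaryMeasure d = 0) : F = 0 := by
  have hF := integrable_of_L2Boundary F
  have hall : ∀ s, MeasurableSet s → ∫ ω in s, F ω ∂boundaryMeasure d = 0 := by
    intro s hs
    induction s, hs using MeasurableSpace.induction_on_inter generateFrom_cylinder
      isPiSystem_cylinder with
    | empty => simp
    | basic t ht =>
      obtain ⟨x, rfl⟩ := ht
      exact h x
    | compl t ht ih =>
      have h1 := integral_add_compl ht hF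
      have h2 := h []
      rw [cylinder_nil, setIntegral_univ] at h2
      rwa [ih, h2, zero_add] at h1
    | iUnion f hd hm ih =>
      rw [integral_iUnion hm hd hF.integrableOn]
      simp [ih]
  rw [Lp.eq_zero_iff_ae_eq_zero]
  exact Integrable.ae_eq_zero_of_forall_setIntegral_eq_zero hF fun s hs _ => hall s hs

theorem inner_cylinderIndicator (x : Vertex d) (F : L2Boundary d) :
    inner ℂ (cylinderIndicator x) F = ∫ ω in cylinder x, F ω ∂boundaryMeasure d :=
  L2.inner_indicatorConstLp_one _ _ F

theorem inner_cylinderIndicator_cylinderIndicator (x y : Vertex d) :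
    inner ℂ (cylinderIndicator x) (cylinderIndicator y) =
      ((boundaryMeasure d).real (cylinder x ∩ cylinder y) : ℂ) :=
  L2.inner_indicatorConstLp_one_indicatorConstLp_one _ _

/-- The normalized characteristic functions of the cylinders. -/
def unitIndicator (x : Vertex d) : L2Boundary d :=
  ((√((d : ℝ) ^ x.length) : ℝ) : ℂ) • cylinderIndicator x

theorem sqrt_pow_ne_zero (n : ℕ) : ((√((d : ℝ) ^ n) : ℝ) : ℂ) ≠ 0 := by
  have : (0 : ℝ) < d := by exact_mod_cast NeZero.pos d
  exact_mod_cast (Real.sqrt_pos.2 (pow_pos this n)).ne'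

theorem inner_unitIndicator (x y : Vertex d) :
    inner ℂ (unitIndicator x) (unitIndicator y) = ((√((d : ℝ) ^ x.length) : ℝ) : ℂ) *
      (((√((d : ℝ) ^ y.length) : ℝ) : ℂ) *
        ((boundaryMeasure d).real (cylinder x ∩ cylinder y) : ℂ)) := by
  rw [unitIndicator, unitIndicator, inner_smul_left, inner_smul_right,
    inner_cylinderIndicator_cylinderIndicator, Complex.conj_ofReal]

theorem isTreeSystem_unitIndicator : IsTreeSystem (unitIndicator : Vertex d → L2Boundary d) where
  norm_eq_one x := by
    have h := inner_unitIndicator x x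
    have hd : (d : ℂ) ≠ 0 := by exact_mod_cast NeZero.ne d
    rw [Set.inter_self, boundaryMeasure_real_cylinder, ← mul_assoc, sqrt_pow_mul_self,
      inner_self_eq_norm_sq_to_K] at h
    push_cast at h
    rw [mul_inv_cancel₀ (pow_ne_zero _ hd)] at h
    have h2 : ‖unitIndicator x‖ ^ 2 = 1 := Complex.ofReal_injective (by simpa using h)
    exact (pow_eq_one_iff_of_nonneg (norm_nonneg _) two_ne_zero).1 h2
  inner_eq_zero x y h h' := by
    rw [inner_unitIndicator, (disjoint_cylinder h h').inter_eq]
    simp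
  inner_cons x y i j h := by
    rw [inner_unitIndicator, inner_unitIndicator,
      Set.inter_eq_right.2 (cylinder_subset (h.trans (List.suffix_cons i x))),
      Set.inter_eq_right.2 (cylinder_subset (h.trans (List.suffix_cons j x))),
      boundaryMeasure_real_cylinder, boundaryMeasure_real_cylinder]
    rfl

theorem setIntegral_eq_inner (x : Vertex d) (F : L2Boundary d) :
    ∫ ω in cylinder x, F ω ∂boundaryMeasure d =
      ((√((d : ℝ) ^ x.length) : ℝ) : ℂ)⁻¹ * inner ℂ (unitIndicator x) F := by
  rw [unitIndicator, inner_smul_left, Complex.conj_ofReal,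
    inv_mul_cancel_left₀ (sqrt_pow_ne_zero _), inner_cylinderIndicator]

/-- A Hilbert basis of `L²(Ω)`. -/
theorem exists_hilbertBasis_L2Boundary (d : ℕ) [NeZero d] :
    ∃ b : HilbertBasis (WaveletIndex d) ℂ (L2Boundary d),
      ∀ k, b k = wavelet unitIndicator k := by
  refine ⟨HilbertBasis.mkOfOrthogonalEqBot
    (isTreeSystem_unitIndicator (d := d)).orthonormal_wavelet ?_, fun k => ?_⟩
  · rw [Submodule.eq_bot_iff]
    intro F hF
    have hk : ∀ k, inner ℂ (wavelet unitIndicator k) F = 0 := fun k =>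
      (Submodule.mem_orthogonal _ _).1 hF _ (Submodule.subset_span ⟨k, rfl⟩)
    -- Orthogonality to the wavelets makes the integrals over sibling cylinders equal; they add up
    -- to the integral over the parent cylinder, so all vanish by induction from the root.
    refine eq_zero_of_setIntegral_cylinder fun x => ?_
    induction x with
    | nil =>
      rw [setIntegral_eq_inner]
      exact mul_eq_zero_of_right _ (hk none)
    | cons i x ih =>
      have heq : ∀ j, ∫ ω in cylinder (j :: x), F ω ∂boundaryMeasure d =
          ∫ ω in cylinder (i :: x), F ω ∂boundaryMeasure d := fun j => by
        rw [setIntegral_eq_inner, setIntegral_eq_inner, inner_cons_eq_of_forall_wavelet hk x j i]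
        rfl
      rw [setIntegral_cylinder, Finset.sum_congr rfl fun j _ => heq j] at ih
      have hd : (d : ℂ) ≠ 0 := by exact_mod_cast NeZero.ne d
      simpa [hd] using ih
  · rw [HilbertBasis.coe_mkOfOrthogonalEqBot]

end Cylinder

/-! ### The path from the root to a vertex. -/

variable {d : ℕ}

theorem pathTo_length {y : Vertex d} {i : ℕ} (hi : i ≤ y.length) : (pathTo y i).length = i := by
  rw [pathTo, List.length_drop]; omega

theorem pathTo_suffix (y : Vertex d) (i : ℕ) : pathTo y i <:+ y :=
  List.drop_suffix _ _

theorem pathTo_of_suffix {x y : Vertex d} (h : x <:+ y) : pathTo y x.length = x :=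
  (List.suffix_iff_eq_drop.1 h).symm

theorem exists_pathTo_eq_cons {y : Vertex d} {i : ℕ} (hi : 1 ≤ i) (hiy : i ≤ y.length) :
    ∃ j, pathTo y i = j :: pathTo y (i - 1) := by
  have h := List.drop_eq_getElem_cons (l := y) (i := y.length - i) (by omega)
  exact ⟨_, h.trans (by rw [pathTo]; congr 2; omega)⟩

theorem not_cons_suffix_self (x : Vertex d) (i : Fin d) : ¬ i :: x <:+ x := fun h => by
  simpa using h.length_le

variable [NeZero d] {lam bet : ℕ → ℝ} {z : ℂ}

/-! ### The correspondence of `L²(Ω)` with the deficiency space -/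

section Correspondence

variable (hs : ∀ k, Summable (alphaTerm d lam bet z k))

theorem ofReal_alpha_ne_zero (hlam : ∀ n, 0 < lam n) {k : ℕ}
    (hs : Summable (alphaTerm d lam bet z k)) : (alpha d lam bet z k : ℂ) ≠ 0 := by
  exact_mod_cast (alpha_pos hlam hs).ne'

theorem boundaryF_eq (x : Vertex d) : boundaryF lam bet z x =
    (alpha d lam bet z x.length : ℂ) • unitIndicator x := by
  rw [boundaryF, unitIndicator, smul_smul, Complex.ofReal_mul]

theorem radialVector_eq (hlam : ∀ n, 0 < lam n) (x : Vertex d) : radialVector hs x =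
    (alpha d lam bet z x.length : ℂ) • unitRadialVector hs x := by
  rw [unitRadialVector, smul_inv_smul₀ (ofReal_alpha_ne_zero hlam (hs _))]

theorem sum_smul_boundaryF (x : Vertex d) (a : Fin d → ℂ) :
    ∑ i, a i • boundaryF lam bet z (succ x i) =
      (alpha d lam bet z (x.length + 1) : ℂ) • ∑ i, a i • unitIndicator (i :: x) := by
  rw [Finset.smul_sum]
  refine Finset.sum_congr rfl fun i _ => ?_
  rw [boundaryF_eq, smul_comm]
  rfl

/-- The norm `α` depends only on the level. Zero-sum combinations of the `F_{x_i}` and of the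
`f_{x_i}` are therefore the same multiple of the combinations of unit vectors, and these expand in
the wavelets with identical coefficients. -/
theorem isBoundaryCorrespondence_of_wavelet (hlam : ∀ n, 0 < lam n)
    {U : L2Boundary d ≃ₗᵢ[ℂ] deficiencySpace (jacobiOperator d lam bet) z}
    (hU : ∀ k, (U (wavelet unitIndicator k) : L2Tree d) = wavelet (unitRadialVector hs) k) :
    IsBoundaryCorrespondence (radialVector hs) U where
  map_root := by
    rw [boundaryF_eq, map_smul, radialVector_eq hs hlam, Submodule.coe_smul]
    exact congrArg (_ • ·) (hU none)
  map_succ x a ha := by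
    have ha' : WithLp.toLp 2 a ∈ zeroSum d := ha
    have h1 : ∑ i, a i • radialVector hs (succ x i) =
        (alpha d lam bet z (x.length + 1) : ℂ) • ∑ i, a i • unitRadialVector hs (i :: x) := by
      rw [sum_smul_unitRadialVector, smul_inv_smul₀ (ofReal_alpha_ne_zero hlam (hs _))]
    rw [h1, sum_smul_boundaryF, map_smul, sum_smul_eq_sum_wavelet _ x ha',
      sum_smul_eq_sum_wavelet _ x ha', map_sum, Submodule.coe_smul, Submodule.coe_sum]
    congr 1
    refine Finset.sum_congr rfl fun j _ => ?_
    rw [map_smul, Submodule.coe_smul, hU]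

theorem IsBoundaryCorrespondence.apply_wavelet (hlam : ∀ n, 0 < lam n)
    {U : L2Boundary d ≃ₗᵢ[ℂ] deficiencySpace (jacobiOperator d lam bet) z}
    (hU : IsBoundaryCorrespondence (radialVector hs) U) (k : WaveletIndex d) :
    (U (wavelet unitIndicator k) : L2Tree d) = wavelet (unitRadialVector hs) k := by
  rcases k with _ | ⟨x, j⟩
  · have h := hU.map_root
    rw [boundaryF_eq, map_smul, radialVector_eq hs hlam, Submodule.coe_smul] at h
    exact smul_right_injective _ (ofReal_alpha_ne_zero hlam (hs _)) h
  · have h := hU.map_succ x _ (stdOrthonormalBasis ℂ (zeroSum d) j).2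
    rw [sum_smul_boundaryF, map_smul, Submodule.coe_smul] at h
    rw [wavelet, wavelet, sum_smul_unitRadialVector, ← h,
      inv_smul_smul₀ (ofReal_alpha_ne_zero hlam (hs _))]

theorem eq_of_apply_wavelet
    {U V : L2Boundary d ≃ₗᵢ[ℂ] deficiencySpace (jacobiOperator d lam bet) z}
    (h : ∀ k, U (wavelet unitIndicator k) = V (wavelet unitIndicator k)) : U = V := by
  obtain ⟨b, hb⟩ := exists_hilbertBasis_L2Boundary d
  have hext : (U.toContinuousLinearEquiv : L2Boundary d →L[ℂ]
      deficiencySpace (jacobiOperator d lam bet) z) =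
      (V.toContinuousLinearEquiv : L2Boundary d →L[ℂ]
      deficiencySpace (jacobiOperator d lam bet) z) := by
    refine ContinuousLinearMap.ext_on
      (Submodule.dense_iff_topologicalClosure_eq_top.2 b.dense_span) ?_
    rintro _ ⟨k, rfl⟩
    rw [hb]
    exact h k
  ext1 F
  exact congrArg (fun A : L2Boundary d →L[ℂ] _ => A F) hext

theorem exists_apply_wavelet (hlam : ∀ n, 0 < lam n) :
    ∃ U : L2Boundary d ≃ₗᵢ[ℂ] deficiencySpace (jacobiOperator d lam bet) z,
      ∀ k, (U (wavelet unitIndicator k) : L2Tree d) = wavelet (unitRadialVector hs) k := by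
  classical
  obtain ⟨b, hb⟩ := exists_hilbertBasis_L2Boundary d
  obtain ⟨b', hb'⟩ := exists_hilbertBasis_deficiencySpace hs hlam
  refine ⟨b.repr.trans b'.repr.symm, fun k => ?_⟩
  rw [← hb, ← hb', LinearIsometryEquiv.trans_apply, b.repr_self, b'.repr_symm_single]

end Correspondence

/-! ### The kernel -/

theorem memLp_poissonKernel (f : Vertex d → L2Tree d) (y : Vertex d) :
    MemLp (poissonKernel lam bet z f y) 2 (boundaryMeasure d) := by
  have hind : ∀ x : Vertex d,
      MemLp ((cylinder x).indicator (1 : Boundary d → ℂ)) 2 (boundaryMeasure d) := fun x =>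
    memLp_indicator_const 2 (measurableSet_cylinder x) 1 (Or.inr (measure_ne_top _ _))
  let g : ℕ → Boundary d → ℂ := fun i ω =>
    f (pathTo y i) y / (alpha d lam bet z i : ℂ) * (√((d : ℝ) ^ i) : ℂ)
      * ((cylinder (pathTo y i)).indicator 1 ω
        - 1 / (d : ℂ) * (cylinder (pathTo y (i - 1))).indicator 1 ω)
  have hg : ∀ i, MemLp (g i) 2 (boundaryMeasure d) := fun i =>
    ((hind _).sub ((hind _).const_mul _)).const_mul _
  have hsum : MemLp (fun ω => ∑ i ∈ Finset.Icc 1 y.length, g i ω) 2 (boundaryMeasure d) :=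
    memLp_finsetSum _ fun i _ => hg i
  exact (memLp_const (f (root d) y / (alpha d lam bet z 0 : ℂ))).add hsum

theorem integral_poissonKernel_mul (f : Vertex d → L2Tree d) (y : Vertex d) (F : L2Boundary d) :
    ∫ ω, poissonKernel lam bet z f y ω * F ω ∂boundaryMeasure d =
      f (root d) y / (alpha d lam bet z 0 : ℂ) * ∫ ω in cylinder [], F ω ∂boundaryMeasure d
      + ∑ i ∈ Finset.Icc 1 y.length,
        f (pathTo y i) y / (alpha d lam bet z i : ℂ) * (√((d : ℝ) ^ i) : ℂ)
          * (∫ ω in cylinder (pathTo y i), F ω ∂boundaryMeasure d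
            - 1 / (d : ℂ) * ∫ ω in cylinder (pathTo y (i - 1)), F ω ∂boundaryMeasure d) := by
  have hF := integrable_of_L2Boundary F
  have hind : ∀ x : Vertex d, Integrable ((cylinder x).indicator F) (boundaryMeasure d) := fun x =>
    hF.indicator (measurableSet_cylinder x)
  have hmul : ∀ (x : Vertex d) ω, (cylinder x).indicator (1 : Boundary d → ℂ) ω * F ω
      = (cylinder x).indicator F ω := fun x ω => by
    by_cases h : ω ∈ cylinder x <;> simp [h]
  have hpt : ∀ ω, poissonKernel lam bet z f y ω * F ω =
      f (root d) y / (alpha d lam bet z 0 : ℂ) * F ω + ∑ i ∈ Finset.Icc 1 y.length,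
        f (pathTo y i) y / (alpha d lam bet z i : ℂ) * (√((d : ℝ) ^ i) : ℂ)
          * ((cylinder (pathTo y i)).indicator F ω
            - 1 / (d : ℂ) * (cylinder (pathTo y (i - 1))).indicator F ω) := fun ω => by
    rw [poissonKernel, add_mul, Finset.sum_mul]
    congr 1
    refine Finset.sum_congr rfl fun i _ => ?_
    rw [← hmul, ← hmul]
    ring
  have hterm : ∀ i, Integrable (fun ω => f (pathTo y i) y / (alpha d lam bet z i : ℂ) *
      (√((d : ℝ) ^ i) : ℂ) * ((cylinder (pathTo y i)).indicator F ω
        - 1 / (d : ℂ) * (cylinder (pathTo y (i - 1))).indicator F ω)) (boundaryMeasure d) :=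
    fun i => ((hind _).sub ((hind _).const_mul _)).const_mul _
  simp_rw [hpt]
  rw [integral_add (hF.const_mul _) (integrable_finsetSum _ fun i _ => hterm i),
    integral_const_mul, cylinder_nil, setIntegral_univ, integral_finsetSum _ fun i _ => hterm i]
  congr 1
  refine Finset.sum_congr rfl fun i _ => ?_
  rw [integral_const_mul, integral_sub (hind _) ((hind _).const_mul _), integral_const_mul,
    integral_indicator (measurableSet_cylinder _), integral_indicator (measurableSet_cylinder _)]

/-- The hypothesis excludes exactly the `u` strictly below `w`. For all others the indicator of
`Ω_u` is constant on `Ω_w`, so the mean-zero bracket `1_{Ω_{j :: w}} - (1/d) 1_{Ω_w}` does not see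
it. -/
theorem measure_cylinder_cons_inter (w : Vertex d) (j : Fin d) {u : Vertex d}
    (h : u <:+ w ∨ ¬ w <:+ u) :
    (boundaryMeasure d).real (cylinder (j :: w) ∩ cylinder u) =
      (d : ℝ)⁻¹ * (boundaryMeasure d).real (cylinder w ∩ cylinder u) := by
  by_cases hu : u <:+ w
  · rw [Set.inter_eq_left.2 (cylinder_subset hu),
      Set.inter_eq_left.2 (cylinder_subset (hu.trans (List.suffix_cons j w))),
      boundaryMeasure_real_cylinder, boundaryMeasure_real_cylinder, List.length_cons, pow_succ,
      mul_inv, mul_comm]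
  · have hd := disjoint_cylinder (h.resolve_left hu) hu
    rw [hd.inter_eq, (hd.mono_left (cylinder_subset (List.suffix_cons j w))).inter_eq]
    simp

theorem setIntegral_unitIndicator (w u : Vertex d) :
    ∫ ω in cylinder w, unitIndicator u ω ∂boundaryMeasure d =
      ((√((d : ℝ) ^ u.length) : ℝ) : ℂ) *
        ((boundaryMeasure d).real (cylinder w ∩ cylinder u) : ℂ) := by
  rw [setIntegral_eq_inner, inner_unitIndicator, inv_mul_cancel_left₀ (sqrt_pow_ne_zero _)]

theorem setIntegral_cylinder_cons_unitIndicator (w : Vertex d) (j : Fin d) {u : Vertex d}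
    (h : u <:+ w ∨ ¬ w <:+ u) :
    ∫ ω in cylinder (j :: w), unitIndicator u ω ∂boundaryMeasure d
      - 1 / (d : ℂ) * ∫ ω in cylinder w, unitIndicator u ω ∂boundaryMeasure d = 0 := by
  rw [setIntegral_unitIndicator, setIntegral_unitIndicator, measure_cylinder_cons_inter w j h]
  push_cast
  ring

theorem setIntegral_sum_unitIndicator (w x : Vertex d) (a : Fin d → ℂ) :
    ∫ ω in cylinder w, (∑ i, a i • unitIndicator (i :: x) : L2Boundary d) ω ∂boundaryMeasure d =
      ∑ i, a i * ∫ ω in cylinder w, unitIndicator (i :: x) ω ∂boundaryMeasure d := by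
  rw [← inner_cylinderIndicator, inner_sum]
  refine Finset.sum_congr rfl fun i _ => ?_
  rw [inner_smul_right, inner_cylinderIndicator]

theorem setIntegral_sum_unitIndicator_eq_zero {w x : Vertex d} (h : ∀ i, ¬ i :: x <:+ w)
    {a : Fin d → ℂ} (ha : ∑ i, a i = 0) :
    ∫ ω in cylinder w, (∑ i, a i • unitIndicator (i :: x) : L2Boundary d) ω ∂boundaryMeasure d
      = 0 := by
  rw [setIntegral_eq_inner, isTreeSystem_unitIndicator.inner_sum_eq_zero h ha, mul_zero]

/-- The kernel bracket at `w` pairs to zero with every wavelet placed at another vertex. If `w` lies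
in the subtree of a successor of `x`, each summand separately is constant on `Ω_w`; otherwise both
integrals vanish because the coefficients sum to zero. -/
theorem setIntegral_cylinder_cons_sub_of_ne {w x : Vertex d} (hwx : w ≠ x) (j : Fin d)
    {a : Fin d → ℂ} (ha : ∑ i, a i = 0) :
    ∫ ω in cylinder (j :: w),
        (∑ i, a i • unitIndicator (i :: x) : L2Boundary d) ω ∂boundaryMeasure d
      - 1 / (d : ℂ) * ∫ ω in cylinder w,
        (∑ i, a i • unitIndicator (i :: x) : L2Boundary d) ω ∂boundaryMeasure d = 0 := by
  by_cases h : ∃ i : Fin d, i :: x <:+ w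
  · obtain ⟨i, hi⟩ := h
    rw [setIntegral_sum_unitIndicator, setIntegral_sum_unitIndicator, Finset.mul_sum,
      ← Finset.sum_sub_distrib]
    refine Finset.sum_eq_zero fun k _ => ?_
    have hk : k :: x <:+ w ∨ ¬ w <:+ k :: x := by
      by_contra! hk
      exact hk.1 ((hi.trans hk.2).eq_of_length (by simp) ▸ hi)
    rw [mul_left_comm, ← mul_sub, setIntegral_cylinder_cons_unitIndicator w j hk, mul_zero]
  · push Not at h
    rw [setIntegral_sum_unitIndicator_eq_zero h ha, setIntegral_sum_unitIndicator_eq_zero _ ha]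
    · simp
    · intro i hi
      rcases List.suffix_cons_iff.1 hi with hi | hi
      · exact hwx (List.cons_eq_cons.1 hi).2.symm
      · exact h i hi

/-- On `Ω_x` the zero sum kills the integral, and on `Ω_{x_j}` orthonormality of the siblings
selects `a j`. The remaining factor is what the `√(d^i)` of the kernel, with `i = |x| + 1`, cancels.
-/
theorem setIntegral_cylinder_cons_sub_self (x : Vertex d) (j : Fin d)
    {a : Fin d → ℂ} (ha : ∑ i, a i = 0) :
    ∫ ω in cylinder (j :: x),
        (∑ i, a i • unitIndicator (i :: x) : L2Boundary d) ω ∂boundaryMeasure d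
      - 1 / (d : ℂ) * ∫ ω in cylinder x,
        (∑ i, a i • unitIndicator (i :: x) : L2Boundary d) ω ∂boundaryMeasure d =
      ((√((d : ℝ) ^ (x.length + 1)) : ℝ) : ℂ)⁻¹ * a j := by
  rw [setIntegral_sum_unitIndicator_eq_zero (not_cons_suffix_self x) ha, mul_zero, sub_zero,
    setIntegral_eq_inner]
  congr 1
  have h := (isTreeSystem_unitIndicator (d := d)).orthonormal_children x
  exact h.inner_right_fintype a j

theorem integral_poissonKernel_mul_wavelet
    (hs : ∀ k, Summable (alphaTerm d lam bet z k)) (y : Vertex d) (k : WaveletIndex d) :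
    ∫ ω, poissonKernel lam bet z (radialVector hs) y ω *
        (wavelet unitIndicator k : L2Boundary d) ω ∂boundaryMeasure d =
      wavelet (unitRadialVector hs) k y := by
  rw [integral_poissonKernel_mul]
  rcases k with _ | ⟨x, l⟩
  · rw [Finset.sum_eq_zero]
    · simp only [wavelet, unitRadialVector]
      rw [setIntegral_unitIndicator, cylinder_nil]
      simp [div_eq_inv_mul]
    · intro i hi
      rw [Finset.mem_Icc] at hi
      obtain ⟨j, hj⟩ := exists_pathTo_eq_cons hi.1 hi.2
      rw [hj]
      simp only [wavelet]
      rw [setIntegral_cylinder_cons_unitIndicator _ j (Or.inl List.nil_suffix), mul_zero]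
  · simp only [wavelet]
    have ha := (stdOrthonormalBasis ℂ (zeroSum d) l).2
    set a := (stdOrthonormalBasis ℂ (zeroSum d) l : EuclideanSpace ℂ (Fin d))
    rw [setIntegral_sum_unitIndicator_eq_zero (fun i h => by simp at h) ha, mul_zero, zero_add,
      sum_smul_unitRadialVector, lp.coeFn_smul, Pi.smul_apply, lp.coeFn_sum, Finset.sum_apply,
      smul_eq_mul]
    simp only [lp.coeFn_smul, Pi.smul_apply, smul_eq_mul]
    by_cases h : ∃ j : Fin d, j :: x <:+ y
    · obtain ⟨j, hj⟩ := h
      have hlen : x.length + 1 ≤ y.length := hj.length_le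
      have hpj : pathTo y (x.length + 1) = j :: x := pathTo_of_suffix hj
      have hpx : pathTo y x.length = x := pathTo_of_suffix ((List.suffix_cons j x).trans hj)
      have hsum : ∑ i, a i * radialVector hs (i :: x) y = a j * radialVector hs (j :: x) y := by
        refine Fintype.sum_eq_single j fun i hij => ?_
        rw [radialVector_of_notMem, mul_zero]
        intro hi
        rcases List.suffix_or_suffix_of_suffix hi hj with h | h
        · exact hij (List.cons_eq_cons.1 (h.eq_of_length (by simp))).1
        · exact hij (List.cons_eq_cons.1 (h.eq_of_length (by simp))).1.symm
      -- The wavelet at `x` meets only the bracket whose larger cylinder is `Ω_x`, and `x` is the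
      -- vertex `y_{i-1}` of the path exactly for `i = |x| + 1`.
      rw [hsum, Finset.sum_eq_single (x.length + 1)]
      · rw [Nat.add_sub_cancel, hpj, hpx, setIntegral_cylinder_cons_sub_self x j ha]
        have := sqrt_pow_ne_zero (d := d) (x.length + 1)
        field_simp
      · intro i hi hne
        rw [Finset.mem_Icc] at hi
        obtain ⟨m, hm⟩ := exists_pathTo_eq_cons hi.1 hi.2
        have hpne : pathTo y (i - 1) ≠ x := fun h => by
          have := congrArg List.length h
          rw [pathTo_length (by omega)] at this
          omega
        rw [hm, setIntegral_cylinder_cons_sub_of_ne hpne m ha, mul_zero]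
      · intro h
        exact absurd (Finset.mem_Icc.2 ⟨by omega, hlen⟩) h
    · push Not at h
      rw [Finset.sum_eq_zero, Finset.sum_eq_zero, mul_zero]
      · intro i _
        rw [radialVector_of_notMem hs (h i), mul_zero]
      · intro i hi
        rw [Finset.mem_Icc] at hi
        obtain ⟨m, hm⟩ := exists_pathTo_eq_cons hi.1 hi.2
        have hpne : pathTo y (i - 1) ≠ x := fun h' => by
          refine h m ?_
          rw [← h', ← hm]
          exact pathTo_suffix y i
        rw [hm, setIntegral_cylinder_cons_sub_of_ne hpne m ha, mul_zero]

/-- The pairing with the kernel is bilinear whereas the inner product is conjugate linear on the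
left, so the representing vector is the conjugate of `K`. -/
theorem integral_mul_eq_inner {K : Boundary d → ℂ} (hK : MemLp K 2 (boundaryMeasure d))
    (F : L2Boundary d) :
    ∫ ω, K ω * F ω ∂boundaryMeasure d = inner ℂ (hK.star.toLp _) F := by
  rw [L2.inner_def]
  refine integral_congr_ae ?_
  filter_upwards [hK.star.coeFn_toLp] with ω hω
  rw [hω, RCLike.inner_apply]
  simp [mul_comm]

/-- Both sides are bounded linear functionals of `F`, evaluation at `y` being the product with
`δ_y`; they agree on the wavelets, whose span is dense. -/
theorem apply_eq_integral_poissonKernel (hs : ∀ k, Summable (alphaTerm d lam bet z k))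
    {U : L2Boundary d ≃ₗᵢ[ℂ] deficiencySpace (jacobiOperator d lam bet) z}
    (hU : ∀ k, (U (wavelet unitIndicator k) : L2Tree d) = wavelet (unitRadialVector hs) k)
    (y : Vertex d) (F : L2Boundary d) : (U F : L2Tree d) y =
      ∫ ω, poissonKernel lam bet z (radialVector hs) y ω * F ω ∂boundaryMeasure d := by
  obtain ⟨b, hb⟩ := exists_hilbertBasis_L2Boundary d
  have hP := memLp_poissonKernel (lam := lam) (bet := bet) (z := z) (radialVector hs) y
  have hext : (innerSL ℂ (delta y)).comp ((Submodule.subtypeL _).comp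
      (U.toContinuousLinearEquiv : L2Boundary d →L[ℂ]
      deficiencySpace (jacobiOperator d lam bet) z)) = innerSL ℂ (hP.star.toLp _) := by
    refine ContinuousLinearMap.ext_on
      (Submodule.dense_iff_topologicalClosure_eq_top.2 b.dense_span) ?_
    rintro _ ⟨k, rfl⟩
    rw [hb]
    refine (inner_delta y (U (wavelet unitIndicator k) : L2Tree d)).trans ?_
    rw [hU, ← integral_poissonKernel_mul_wavelet hs y k, integral_mul_eq_inner hP]
    rfl
  rw [integral_mul_eq_inner hP, ← inner_delta]
  exact congrArg (fun A : L2Boundary d →L[ℂ] ℂ => A F) hext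

theorem ae_eq_of_integral_mul_eq {K P : Boundary d → ℂ} (hK : MemLp K 2 (boundaryMeasure d))
    (hP : MemLp P 2 (boundaryMeasure d))
    (h : ∀ F : L2Boundary d,
      ∫ ω, K ω * F ω ∂boundaryMeasure d = ∫ ω, P ω * F ω ∂boundaryMeasure d) :
    K =ᵐ[boundaryMeasure d] P := by
  have h1 : hK.star.toLp _ = hP.star.toLp _ := ext_inner_right ℂ fun F => by
    rw [← integral_mul_eq_inner hK, ← integral_mul_eq_inner hP, h]
  rw [MemLp.toLp_eq_toLp_iff] at h1
  filter_upwards [h1] with ω hω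
  exact star_injective hω

end JacobiTree

end

/-! ### The explicit Poisson kernel formula. -/

theorem mainTheorem5 (d : ℕ) [NeZero d] (hd : 2 ≤ d) (lam bet : ℕ → ℝ)
    (hlam : ∀ n, 0 < lam n)
    (hJ : ¬ IsEssentiallySelfAdjoint (jacobiOperator d lam bet))
    (z : ℂ) (hz : z.im ≠ 0) :
    (∀ k, Summable (alphaTerm d lam bet z k) ∧ 0 < alpha d lam bet z k) ∧
    ∃ f : Vertex d → L2Tree d,
      (∀ x g, IsRadialDeficiencyFunction lam bet z x g ↔ g = f x) ∧
      (∀ x, ‖f x‖ = alpha d lam bet z x.length) ∧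
      ∃ U : L2Boundary d ≃ₗᵢ[ℂ] deficiencySpace (jacobiOperator d lam bet) z,
        (∀ V : L2Boundary d ≃ₗᵢ[ℂ] deficiencySpace (jacobiOperator d lam bet) z,
          IsBoundaryCorrespondence f V ↔ V = U) ∧
        ∀ y : Vertex d,
          MemLp (poissonKernel lam bet z f y) 2 (boundaryMeasure d) ∧
          (∀ F : L2Boundary d,
            (U F : L2Tree d) y = ∫ ω, poissonKernel lam bet z f y ω * F ω ∂(boundaryMeasure d)) ∧
          ∀ K : Boundary d → ℂ, MemLp K 2 (boundaryMeasure d) →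
            (∀ F : L2Boundary d, (U F : L2Tree d) y = ∫ ω, K ω * F ω ∂(boundaryMeasure d)) →
            K =ᵐ[boundaryMeasure d] poissonKernel lam bet z f y := by
  have hs : ∀ k, Summable (alphaTerm d lam bet z k) := fun k =>
    (summable_radialCoeff hlam hJ hz k).congr fun n => norm_radialCoeff_sq k n
  obtain ⟨U, hU⟩ := exists_apply_wavelet hs hlam
  refine ⟨fun k => ⟨hs k, alpha_pos hlam (hs k)⟩, radialVector hs, fun x g => ⟨fun hg => ?_, ?_⟩,
    norm_radialVector hs, U, fun V => ⟨fun hV => ?_, ?_⟩, fun y =>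
      ⟨memLp_poissonKernel _ y, apply_eq_integral_poissonKernel hs hU y, fun K hK h => ?_⟩⟩
  · exact hg.unique hlam (isRadialDeficiencyFunction_radialVector hs hlam x)
  · rintro rfl
    exact isRadialDeficiencyFunction_radialVector hs hlam x
  · refine eq_of_apply_wavelet fun k => Subtype.ext ?_
    rw [hU, hV.apply_wavelet hs hlam]
  · rintro rfl
    exact isBoundaryCorrespondence_of_wavelet hs hlam hU
  · exact ae_eq_of_integral_mul_eq hK (memLp_poissonKernel _ y) fun F =>
      (h F).symm.trans (apply_eq_integral_poissonKernel hs hU y F)
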